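/- Let $X$ be a simplicial complete toric surface over $\mathbb{C}$ with fan $\Sigma$ in $\mathbb{R}^2$, let $v_1,\dots,v_m\in\mathbb{Z}^2$ be the primitive generators of its rays, $D_1,\dots,D_m$ the corresponding torus invariant prime divisors, and $S=S_X=\mathbb{C}[z_1,\dots,z_m]$ its homogeneous coordinate ring, graded by $\mathrm{Cl}(X)$ with $\deg z_i=[D_i]$. Let $I_Z=\langle \prod_{v_i\notin\sigma}z_i : \sigma\in\Sigma\rangle$ be the irrelevant ideal, $Z=V(I_Z)\subset\mathbb{C}^m$, and $I_{ij}=\langle z_i,z_j\rangle$. For a polynomial 1-form $\alpha=\sum A_i\,dz_i$ let $J(\alpha)=\langle A_i\rangle_i$, let $\mathscr{C}(d\alpha)$ be the ideal generated by the coefficients of $d\alpha$, and put $K(\alpha)=(J(\alpha):\mathscr{C}(d\alpha))$ and $I(\alpha)=\{h : h\,d\alpha=\alpha\wedge\eta\text{ for some polynomial 1-form }\eta\}$. A prime $\mathfrak p$ is a division point of $\alpha$ if $1\in I(\alpha)_{\mathfrak p}$. For ideals put $(J:I^\infty)=\bigcup_{d\ge1}(J:I^d)$. Let $\alpha=\sum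 A_i\,dz_i$ define a codimension one foliation of degree $D\in\mathrm{Cl}(X)$ on $X$: $A_i\in S_{D-[D_i]}$; $\sum_i a_iz_iA_i=0$ for all $a\in\mathbb{Z}^m$ with $\sum_i a_iv_i=0$; $\alpha\wedge d\alpha=0$; and the singular set $\{\alpha=0\}\subset X$ has codimension $\ge2$. Let $\Gamma_\alpha$ be the set of pairs $i<j$ such that $v_i,v_j$ do not span a cone of $\Sigma$ and $J(\alpha)\subset I_{ij}$ (there are none if $m=3$), and let $\Gamma_{\alpha,\mathcal K}=\{(i,j)\in\Gamma_\alpha : K(\alpha)\subset I_{ij}\}$. Let $F=(F_1,\dots,F_m)$ be a polynomial lifting of a rational map $\mathbb{P}^n\dashrightarrow X$, where $F_i\in S_{\mathbb{P}^n}=\mathbb{C}[x_0,\dots,x_n]$ is homogeneous of degree $e_i\ge 0$ and $\sum_i e_iv_i=0$. Suppose that $F^*:S_X\to S_{\mathbb{P}^n}$, $z_i\mapsto F_i$, is flat (this forces the rational map to be dominant and the lifting to be complete, i.e. its indeterminacy locus is exactly the image of $F^{-1}(Z)$). For an ideal $I\subset S_X$ let $F^*(I)$ be the ideal of $S_{\mathbb{P}^n}$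 generated by its image. Put $\omega=F^*\alpha=\sum_i A_i(F)\,dF_i$ and $\widetilde J(\omega)=F^*(J(\alpha))$. Let $C(F)\subset\mathbb{P}^n$ be the set of critical points of the rational map: the points $[x]$ with $F(x)\notin Z$ for which the image of the differential of $F$ at $x$, together with the vectors $(a_1F_1(x),\dots,a_mF_m(x))$ with $a\in\mathbb{Z}^m$, $\sum_i a_iv_i=0$, does not span $\mathbb{C}^m$. Assume that $(F,\alpha)$ is almost generic, i.e. (I) no critical value of $F$ is a singular point of $\alpha$, and the scheme $\mathrm{Sing}(\omega)\subset\mathbb{P}^n$ defined by $J(\omega)$ is reduced at every point of $C(F)$; (II) $(J(\alpha):I_Z^\infty)$ is a radical ideal of codimension $\ge2$; (III) $(K(\alpha):I_Z^\infty)=(J(\alpha):I_Z^\infty)$. (In (II), the unit ideal counts as radical and of codimension $\ge2$.) Assume moreover that $I_{ij}$ is a division point of $\alpha$ for every $(i,j)\in\Gamma_\alpha\setminus\Gamma_{\alpha,\mathcal K}$. Then: 1) $(\widetilde J(\omega):F^*(I_Z)^\infty)=(F^*(I(\alpha)):F^*(I_Z)^\infty)=(I(\omega):F^*(I_Z)^\infty)=(K(\omega):F^*(I_Z)^\infty)$;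 2) $\sqrt{F^*(I(\alpha))}=\sqrt{I(\omega)}=\sqrt{K(\omega)}$. -/

import Mathlib

open MvPolynomial

noncomputable section

namespace ToricFoliation

/-! ### Polynomial differential forms on affine space

Over `S = ℂ[z_i : i ∈ σ]` the module of Kähler differentials is free on the `dz_i`, and its second
exterior power is free on the `dz_i ∧ dz_j`; forms are given by their coefficients. -/

section Forms

variable {σ : Type*}

/-- A polynomial 1-form `∑ A_i dz_i`, given by its coefficients `A_i`. -/
abbrev OneForm (σ : Type*) := σ → MvPolynomial σ ℂ

/-- A polynomial 2-form `∑_{i<j} B_ij dz_i ∧ dz_j`, given by its antisymmetric matrix of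
coefficients `B_ij`. -/
abbrev TwoForm (σ : Type*) := σ → σ → MvPolynomial σ ℂ

/-- The exterior derivative of `∑ A_i dz_i`. -/
def extD (A : OneForm σ) : TwoForm σ := fun i j => pderiv i (A j) - pderiv j (A i)

/-- The exterior product of two 1-forms. -/
def wedge (A B : OneForm σ) : TwoForm σ := fun i j => A i * B j - A j * B i

/-- Frobenius integrability `α ∧ dα = 0`; the displayed expression is the coefficient of
`dz_i ∧ dz_j ∧ dz_k` (it vanishes identically if two of the indices agree). -/
def IsIntegrable (A : OneForm σ) : Prop :=
  ∀ i j k, A i * extD A j k - A j * extD A i k + A k * extD A i j = 0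

/-- The singular ideal `J(α)`, generated by the coefficients of `α`. -/
def singularIdeal (A : OneForm σ) : Ideal (MvPolynomial σ ℂ) := Ideal.span (Set.range A)

/-- The ideal `𝒞(η)` generated by the coefficients of the 2-form `η`. -/
def coeffIdeal (B : TwoForm σ) : Ideal (MvPolynomial σ ℂ) :=
  Ideal.span {f | ∃ i j, f = B i j}

/-- The Kupka ideal `K(α) = (J(α) : 𝒞(dα))`. Since 2-forms are a free module, this is the
annihilator of the class of `dα` in `Ω² ⊗ S/J(α)` (and it contains `J(α)`). -/
def kupkaIdeal (A : OneForm σ) : Ideal (MvPolynomial σ ℂ) :=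
  (singularIdeal A).colon (coeffIdeal (extD A) : Set (MvPolynomial σ ℂ))

/-- The unfoldings ideal `I(α) = {h : h dα = α ∧ η for some 1-form η}`. -/
def unfoldingsIdeal (A : OneForm σ) : Ideal (MvPolynomial σ ℂ) where
  carrier := {h | ∃ η : OneForm σ, h • extD A = wedge A η}
  zero_mem' := ⟨0, by ext1 i; ext1 j; simp [wedge]⟩
  add_mem' := by
    rintro a b ⟨η, hη⟩ ⟨θ, hθ⟩
    refine ⟨η + θ, ?_⟩
    rw [add_smul, hη, hθ]
    ext1 i; ext1 j
    simp only [wedge, Pi.add_apply]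
    ring
  smul_mem' := by
    rintro c a ⟨η, hη⟩
    refine ⟨c • η, ?_⟩
    rw [smul_assoc, hη]
    ext1 i; ext1 j
    simp only [wedge, Pi.smul_apply, smul_eq_mul]
    ring

/-- A prime ideal `𝔭` is a division point of `α` if `1 ∈ I(α)_𝔭`. -/
def IsDivisionPoint (A : OneForm σ) (p : Ideal (MvPolynomial σ ℂ)) : Prop :=
  ∃ _ : p.IsPrime, (1 : Localization.AtPrime p) ∈
    (unfoldingsIdeal A).map (algebraMap (MvPolynomial σ ℂ) (Localization.AtPrime p))

/-- The pullback `F^*α = ∑ A_i(F) dF_i` of a 1-form under a polynomial map `F = (F_i)`. -/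
def pullback {τ : Type*} [Fintype σ] (F : σ → MvPolynomial τ ℂ) (A : OneForm σ) : OneForm τ :=
  fun k => ∑ i, aeval F (A i) * pderiv k (F i)

end Forms

/-- The saturation `(J : I^∞) = ⋃_{d ≥ 1} (J : I^d)`. -/
def saturation {R : Type*} [CommRing R] (J I : Ideal R) : Ideal R where
  carrier := {h | ∃ d : ℕ, 1 ≤ d ∧ h ∈ J.colon ((I ^ d : Ideal R) : Set R)}
  zero_mem' := ⟨1, le_rfl, Ideal.zero_mem _⟩
  add_mem' := by
    rintro a b ⟨d, hd, ha⟩ ⟨e, _, hb⟩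
    refine ⟨d + e, by omega, Ideal.add_mem _ ?_ ?_⟩
    · exact Submodule.colon_mono le_rfl (Ideal.pow_le_pow_right (Nat.le_add_right d e)) ha
    · exact Submodule.colon_mono le_rfl (Ideal.pow_le_pow_right (Nat.le_add_left e d)) hb
  smul_mem' := by
    rintro c a ⟨d, hd, ha⟩
    exact ⟨d, hd, Ideal.mul_mem_left _ c ha⟩

/-! ### Simplicial complete toric surfaces -/

/-- The cone in `ℝ²` generated by the vectors `v i`, `i ∈ s`. -/
def coneOf {m : ℕ} (v : Fin m → Fin 2 → ℤ) (s : Finset (Fin m)) : Set (Fin 2 → ℝ) :=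
  {p | ∃ c : Fin m → ℝ, (∀ i, 0 ≤ c i) ∧ p = ∑ i ∈ s, c i • fun k => (v i k : ℝ)}

/-- A complete simplicial fan in `ℝ²` with `m` rays, i.e. a simplicial complete toric surface with
a numbering of its torus invariant prime divisors `D_1, …, D_m`. A cone of the fan is recorded as
the set of its rays. -/
structure ToricSurface (m : ℕ) where
  /-- the primitive lattice vectors generating the rays -/
  ray : Fin m → Fin 2 → ℤ
  /-- the cones of the fan -/
  cones : Set (Finset (Fin m))
  primitive : ∀ i, IsCoprime (ray i 0) (ray i 1)
  ray_mem : ∀ i, {i} ∈ cones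
  face_mem : ∀ s ∈ cones, ∀ t, t ⊆ s → t ∈ cones
  simplicial : ∀ s ∈ cones,
    LinearIndependent ℝ (fun i : s => fun k => (ray (i : Fin m) k : ℝ))
  inter : ∀ s ∈ cones, ∀ t ∈ cones, coneOf ray s ∩ coneOf ray t = coneOf ray (s ∩ t)
  complete : ∀ p : Fin 2 → ℝ, ∃ s ∈ cones, p ∈ coneOf ray s

namespace ToricSurface

variable {m : ℕ} (X : ToricSurface m)

/-- The map sending a character `u` of the torus to the coefficients `⟨u, v_i⟩` of its divisor. -/
def divOfChar : (Fin 2 → ℤ) →+ (Fin m → ℤ) where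
  toFun u := fun i => ∑ k, u k * X.ray i k
  map_zero' := by ext i; simp
  map_add' u w := by ext i; simp only [Pi.add_apply, add_mul, Finset.sum_add_distrib]

/-- The Weil divisor class group `Cl(X)`: torus invariant divisors modulo divisors of
characters. -/
abbrev Cl := (Fin m → ℤ) ⧸ X.divOfChar.range

/-- The class `[D_i] = deg z_i`; it defines the `Cl(X)`-grading of the homogeneous coordinate ring
`ℂ[z_1, …, z_m]`. -/
def degVar (i : Fin m) : X.Cl := QuotientAddGroup.mk (Pi.single i 1)

/-- The integral relations `∑ a_i v_i = 0` among the rays. -/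
def IsRelation (a : Fin m → ℤ) : Prop := ∑ i, a i • X.ray i = 0

/-- `∑ A_i dz_i` is a global section of the Zariski 1-forms of `X` twisted by `D`, in homogeneous
coordinates: `A_i` is homogeneous of degree `D - D_i`, and the contractions with the radial vector
fields `∑ a_i z_i ∂/∂z_i` vanish. -/
structure IsTwistedForm (D : X.Cl) (A : OneForm (Fin m)) : Prop where
  homogeneous : ∀ i, IsWeightedHomogeneous X.degVar (A i) (D - X.degVar i)
  descent : ∀ a, X.IsRelation a → ∑ i, C (a i : ℂ) * MvPolynomial.X i * A i = 0

/-- The irrelevant ideal `I_Z`, generated by the monomials `∏_{i ∉ s} z_i`, `s` a cone. -/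
def irrelevantIdeal : Ideal (MvPolynomial (Fin m) ℂ) :=
  Ideal.span {f | ∃ s ∈ X.cones, f = ∏ i ∈ sᶜ, MvPolynomial.X i}

/-- The irrelevant locus `Z`; the points of `X` are the orbits in `ℂ^m ∖ Z` of the group with
character group `Cl(X)`. -/
def irrelevantLocus : Set (Fin m → ℂ) := zeroLocus ℂ X.irrelevantIdeal

/-- `α = ∑ A_i dz_i` defines a codimension one foliation on `X` of degree `D`. The singular set in
`X` is the zero set of `J(α)` away from `Z`, hence its codimension is the height of
`(J(α) : I_Z^∞)`. -/
structure IsFoliation (D : X.Cl) (A : OneForm (Fin m)) : Prop extends X.IsTwistedForm D A where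
  integrable : IsIntegrable A
  codim_sing : 2 ≤ (saturation (singularIdeal A) X.irrelevantIdeal).height

/-- The prime ideal `I_ij = ⟨z_i, z_j⟩`. -/
def primeIdeal (ij : Fin m × Fin m) : Ideal (MvPolynomial (Fin m) ℂ) :=
  Ideal.span {MvPolynomial.X ij.1, MvPolynomial.X ij.2}

/-- `Γ_α`: the pairs `i < j` of non-consecutive rays (i.e. `v_i, v_j` do not span a cone of the
fan) with `J(α) ⊆ I_ij`. There is no such pair if `m = 3`. -/
def gammaSet (A : OneForm (Fin m)) : Set (Fin m × Fin m) :=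
  {ij | ij.1 < ij.2 ∧ {ij.1, ij.2} ∉ X.cones ∧ singularIdeal A ≤ primeIdeal ij}

/-- `Γ_{α,𝒦}`: the pairs in `Γ_α` with `K(α) ⊆ I_ij`. -/
def gammaKupka (A : OneForm (Fin m)) : Set (Fin m × Fin m) :=
  {ij | ij ∈ X.gammaSet A ∧ kupkaIdeal A ≤ primeIdeal ij}

/-- `F = (F_1, …, F_m)` is a homogeneous polynomial lifting of degree `(e_1, …, e_m)`, where
`∑ e_i v_i = 0`, of a rational map from `ℙⁿ` to `X`. -/
structure IsLifting {n : ℕ} (e : Fin m → ℕ) (F : Fin m → MvPolynomial (Fin (n + 1)) ℂ) : Prop where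
  relation : X.IsRelation (fun i => (e i : ℤ))
  homogeneous : ∀ i, (F i).IsHomogeneous (e i)

/-- The affine cone (without the origin) over the set `C(F) ⊆ ℙⁿ` of critical points of the
rational map `ℙⁿ ⇢ X` with lifting `F`, on its domain `F(x) ∉ Z`: the image of the differential of
the lifting at `x` and the tangent space at `F(x)` of the fibre of `ℂ^m ∖ Z → X` (spanned by the
radial vector fields) do not span `ℂ^m`. -/
def criticalCone {n : ℕ} (F : Fin m → MvPolynomial (Fin (n + 1)) ℂ) : Set (Fin (n + 1) → ℂ) :=
  {x | x ≠ 0 ∧ (fun i => eval x (F i)) ∉ X.irrelevantLocus ∧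
    Submodule.span ℂ
      (Set.range (fun k : Fin (n + 1) => fun i : Fin m => eval x (pderiv k (F i))) ∪
        {w | ∃ a : Fin m → ℤ, X.IsRelation a ∧ w = fun i => (a i : ℂ) * eval x (F i)}) ≠ ⊤}

/-- Almost generic pairs `(F, α)`, with `ω = F^*α`. -/
structure AlmostGeneric {n : ℕ} (F : Fin m → MvPolynomial (Fin (n + 1)) ℂ)
    (A : OneForm (Fin m)) : Prop where
  /-- no critical value of `F` is a singular point of `α` -/
  critical : ∀ x ∈ X.criticalCone F, ∃ i, eval (fun j => eval x (F j)) (A i) ≠ 0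
  /-- the scheme defined by `J(ω)` is reduced at every critical point of `F` -/
  reduced : ∀ x ∈ X.criticalCone F,
    ((singularIdeal (pullback F A)).map (algebraMap (MvPolynomial (Fin (n + 1)) ℂ)
      (Localization.AtPrime (vanishingIdeal ℂ {x})))).IsRadical
  radical : (saturation (singularIdeal A) X.irrelevantIdeal).IsRadical
  codim : 2 ≤ (saturation (singularIdeal A) X.irrelevantIdeal).height
  kupka : saturation (kupkaIdeal A) X.irrelevantIdeal =
    saturation (singularIdeal A) X.irrelevantIdeal

end ToricSurface

end ToricFoliation

end

/-! The inclusions `J̃(ω) ⊆ F^*I(α) ⊆ I(ω) ⊆ K(ω)` are formal: integrability gives `J(α) ⊆ I(α)`,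
and the equation `h dα = α ∧ η` pulls back. Everything rests on two upper bounds for `K(ω)`.

Away from `F⁻¹(Z)`: `K(ω) ⊆ (J̃(ω) : F^*(I_Z)^∞)`. At a noncritical point the derivatives of `F` and
the radial fields span, radial contractions of `dα` have coefficients in `J(α)`, and flat extension
commutes with colon ideals; so `K(ω)` lies locally in `F^*K(α)`. At a critical point outside
`F⁻¹(Z)` some `A_i(F)` is nonzero. The Nullstellensatz and (III) conclude
(`kupkaIdeal_pullback_le_saturation`).

Along `F⁻¹(Z)`: `K(ω) ⊆ q` for every minimal prime `q` of `F^*I(α)`. By going down, `q` contracts to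
a minimal prime `p` of `I(α)`. If `p` does not contain `I_Z`, the first bound applies. Otherwise `p`
contains two variables, and since `I(α)` is a colon ideal `((x, y) : e)` of a complete intersection
there is room for nothing more: `p = I_ij` with `(i, j) ∈ Γ_α`, and the division point hypothesis
leaves only `K(α) ⊆ I_ij`.

There the key is that the Jacobian minors of `(F_i, F_j)` do not all lie in `(F_i, F_j)` locally at
`q`, even if this scheme is not reduced (`exists_mul_minor_notMem_span_pair`). If `h ∈ K(ω)` were
outside `q`, isolating the `dz_i ∧ dz_j` coefficient of `dα` and cancelling it by flatness would put
a multiple of every minor, by a factor outside `q`, in `(F_i, F_j)`. Independent and opposite rays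
`v_i, v_j` need different ways to isolate it.

The statement on minors reduces, by slicing at the generic point of `V(q)`, to an Artinian complete
intersection `A` in two variables. There a generator `τ` of the dual of `A` takes the value `dim A`
on the Jacobian, which is nonzero in characteristic zero. -/

open scoped TensorProduct

namespace ToricFoliation

/-! ### Duality for finite local algebras -/

section TraceDuality

variable {K A : Type*} [Field K] [CommRing A] [Algebra K A]

/-- Contraction of the left factor of `A ⊗ A` with a linear functional. -/
noncomputable def contractLeft (φ : A →ₗ[K] K) : A ⊗[K] A →ₗ[K] A :=
  (TensorProduct.lid K A).toLinearMap ∘ₗ φ.rTensor A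

@[simp]
theorem contractLeft_tmul (φ : A →ₗ[K] K) (a b : A) : contractLeft φ (a ⊗ₜ[K] b) = φ a • b := by
  simp [contractLeft]

theorem contractLeft_mul_right (φ : A →ₗ[K] K) (a : A) (z : A ⊗[K] A) :
    contractLeft φ ((1 ⊗ₜ[K] a) * z) = a * contractLeft φ z := by
  induction z using TensorProduct.induction_on with
  | zero => simp
  | tmul x y => simp
  | add x y hx hy => rw [mul_add, map_add, hx, hy, map_add, mul_add]

theorem contractLeft_mul_left (φ : A →ₗ[K] K) (a : A) (z : A ⊗[K] A) :
    contractLeft φ ((a ⊗ₜ[K] 1) * z) = contractLeft (φ ∘ₗ LinearMap.mulLeft K a) z := by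
  induction z using TensorProduct.induction_on with
  | zero => simp
  | tmul x y => simp
  | add x y hx hy => rw [mul_add, map_add, hx, hy, map_add]

/-- For an algebra homomorphism, contraction is the ring map `ε ⊗ id`. -/
theorem contractLeft_algHom_mul (ε : A →ₐ[K] K) (x y : A ⊗[K] A) :
    contractLeft ε.toLinearMap (x * y) =
      contractLeft ε.toLinearMap x * contractLeft ε.toLinearMap y := by
  induction x using TensorProduct.induction_on with
  | zero => simp
  | add x y hx hy => rw [add_mul, map_add, hx, hy, map_add, add_mul]
  | tmul a b =>
    induction y using TensorProduct.induction_on with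
    | zero => simp
    | add x y hx hy => rw [mul_add, map_add, hx, hy, map_add, mul_add]
    | tmul c d => simp [mul_smul_mul_comm]

/-- A nonzero functional on a local Artinian algebra with residue field `K` has a multiple which is
a nonzero multiple of the augmentation. -/
theorem exists_comp_mulLeft_eq_smul (ε : A →ₐ[K] K) (hε : IsNilpotent (RingHom.ker ε))
    (φ : A →ₗ[K] K) (hφ : φ ≠ 0) :
    ∃ (a : A) (c : K), c ≠ 0 ∧ φ ∘ₗ LinearMap.mulLeft K a = c • ε.toLinearMap := by
  classical
  -- Let `n` be least with `φ` zero on the `n`-th power of `ker ε`. An `a` in the previous power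
  -- with `φ(a ·) ≠ 0` works: `x - ε x` lies in `ker ε`, so `φ(a x) = ε(x) φ(a)`.
  have hex : ∃ n, ∀ a ∈ (RingHom.ker ε) ^ n, φ ∘ₗ LinearMap.mulLeft K a = 0 := by
    obtain ⟨n, hn⟩ := hε
    refine ⟨n, fun a ha => ?_⟩
    rw [hn] at ha
    have : a = 0 := by simpa using ha
    subst this
    ext; simp
  have hspec := Nat.find_spec hex
  have hpos : Nat.find hex ≠ 0 := by
    intro h0
    rw [h0] at hspec
    apply hφ
    have := hspec 1 (by simp)
    ext x
    simpa using LinearMap.congr_fun this x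
  obtain ⟨k, hk⟩ := Nat.exists_eq_succ_of_ne_zero hpos
  have hnot := Nat.find_min hex (m := k) (by omega)
  push Not at hnot
  obtain ⟨a, ha, hane⟩ := hnot
  have key : ∀ x, φ (a * x) = ε x * φ a := by
    intro x
    have hx : x - algebraMap K A (ε x) ∈ RingHom.ker ε := by
      rw [RingHom.mem_ker]; simp
    have h1 : a * (x - algebraMap K A (ε x)) ∈ (RingHom.ker ε) ^ (Nat.find hex) := by
      rw [hk, pow_succ]
      exact Ideal.mul_mem_mul ha hx
    have h2 := LinearMap.congr_fun (hspec _ h1) 1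
    simp only [LinearMap.comp_apply, LinearMap.mulLeft_apply, mul_one, LinearMap.zero_apply] at h2
    rw [mul_sub, map_sub, sub_eq_zero] at h2
    rw [h2, mul_comm a, ← Algebra.smul_def, map_smul, smul_eq_mul]
  refine ⟨a, φ a, ?_, ?_⟩
  · intro h0
    apply hane
    ext x
    simp [key, h0]
  · ext x
    simp [key, mul_comm]

/-- A diagonal element of `A ⊗ A` which contracts with the augmentation to a nonzero element has
nonzero image under multiplication. -/
theorem mul'_ne_zero_of_diagonal [CharZero K] [Module.Finite K A] (ε : A →ₐ[K] K)
    (hε : IsNilpotent (RingHom.ker ε)) (Δ : A ⊗[K] A)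
    (hΔ : ∀ a : A, (a ⊗ₜ[K] 1) * Δ = (1 ⊗ₜ[K] a) * Δ)
    (hne : contractLeft ε.toLinearMap Δ ≠ 0) : LinearMap.mul' K A Δ ≠ 0 := by
  classical
  have hlin : ∀ (φ : A →ₗ[K] K) (a : A),
      contractLeft (φ ∘ₗ LinearMap.mulLeft K a) Δ = a * contractLeft φ Δ := by
    intro φ a
    rw [← contractLeft_mul_left, hΔ, contractLeft_mul_right]
  -- By diagonality this map is `A`-linear. A nonzero kernel element would have a multiple
  -- proportional to `ε`, against `hne`; so it is injective, and bijective by dimension.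
  let ψ : (A →ₗ[K] K) →ₗ[K] A :=
    { toFun := fun φ => contractLeft φ Δ
      map_add' := fun φ χ => by simp [contractLeft, LinearMap.rTensor_add]
      map_smul' := fun c φ => by simp [contractLeft, LinearMap.rTensor_smul] }
  have hψ : ∀ φ, ψ φ = contractLeft φ Δ := fun _ => rfl
  have hinj : Function.Injective ψ := by
    rw [← LinearMap.ker_eq_bot, LinearMap.ker_eq_bot']
    intro φ hφ
    by_contra h
    obtain ⟨a, c, hc, hac⟩ := exists_comp_mulLeft_eq_smul ε hε φ h
    have h1 := hlin φ a
    rw [← hψ φ, hφ, mul_zero, hac, ← hψ, map_smul, hψ] at h1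
    exact hne ((smul_eq_zero_iff_right hc).mp h1)
  have hsurj : Function.Surjective ψ :=
    (LinearMap.injective_iff_surjective_of_finrank_eq_finrank
      (Subspace.dual_finrank_eq (K := K) (V := A))).mp hinj
  -- Writing `Δ = ∑ e_i ⊗ b_i`, the `b_i` are dual to the `e_i` for the form `τ(xy)`. Hence `τ(∑ e_i
  -- b_i)` is the trace of the identity, namely `dim A`.
  obtain ⟨τ, hτ⟩ := hsurj 1
  let e := Module.finBasis K A
  obtain ⟨b, hb⟩ := TensorProduct.eq_repr_basis_left e Δ
  rw [Finsupp.sum_fintype _ _ (by simp)] at hb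
  have hdual : ∀ j, ∑ i, τ (e j * e i) • b i = e j := by
    intro j
    have h1 := hlin τ (e j)
    rw [← hψ τ, hτ, mul_one, ← hb] at h1
    simpa using h1
  let M : Matrix (Fin (Module.finrank K A)) (Fin (Module.finrank K A)) K :=
    Matrix.of fun i j => τ (e i * e j)
  let N : Matrix (Fin (Module.finrank K A)) (Fin (Module.finrank K A)) K :=
    Matrix.of fun i j => e.repr (b i) j
  have hMN : M * N = 1 := by
    ext j k
    have h1 := congrArg (fun a => e.repr a k) (hdual j)
    simp only [map_sum, map_smul, Finsupp.coe_finsetSum, Finset.sum_apply, Finsupp.smul_apply,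
      smul_eq_mul, Module.Basis.repr_self] at h1
    rw [Matrix.mul_apply, Matrix.one_apply]
    simpa [M, N, Finsupp.single_apply] using h1
  have htr : τ (LinearMap.mul' K A Δ) = Module.finrank K A := by
    have h1 : Matrix.trace (N * M) = Module.finrank K A := by
      rw [Matrix.trace_mul_comm, hMN, Matrix.trace_one, Fintype.card_fin]
    rw [← h1, ← hb, map_sum, map_sum, Matrix.trace]
    refine Finset.sum_congr rfl fun i _ => ?_
    rw [LinearMap.mul'_apply, Matrix.diag_apply, Matrix.mul_apply]
    conv_lhs => rw [← e.sum_repr (b i)]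
    rw [Finset.mul_sum, map_sum]
    refine Finset.sum_congr rfl fun k _ => ?_
    rw [mul_smul_comm, map_smul, smul_eq_mul, mul_comm (e i)]
    rfl
  intro h0
  rw [h0, map_zero] at htr
  have : Module.finrank K A = 0 := by exact_mod_cast htr.symm
  have hsub : Subsingleton A := Module.finrank_zero_iff.mp this
  exact hne (Subsingleton.elim _ _)

end TraceDuality

/-! ### Divided differences -/

section DifferenceQuotient

variable {K T A : Type*} [Field K] [Fintype T] [DecidableEq T] [CommRing A] [Algebra K A]

/-- A single choice of divided differences `p(x) - p(y) = ∑ c_t (x_t - y_t)` has both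
specialisations: the diagonal `x = y` gives the partial derivatives, and `x = 0` gives cofactors of
`p - p(0)`. -/
theorem exists_difference_quotient (π : MvPolynomial T K →ₐ[K] A) (ε : A →ₐ[K] K)
    (hε : ∀ t, ε (π (X t)) = 0) (p : MvPolynomial T K) :
    ∃ (c : T → A ⊗[K] A) (q : T → MvPolynomial T K),
      π p ⊗ₜ[K] 1 - 1 ⊗ₜ[K] π p = ∑ t, c t * (π (X t) ⊗ₜ[K] 1 - 1 ⊗ₜ[K] π (X t)) ∧
      (∀ t, LinearMap.mul' K A (c t) = π (pderiv t p)) ∧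
      p = C (constantCoeff p) + ∑ t, q t * X t ∧
      ∀ t, contractLeft ε.toLinearMap (c t) = π (q t) := by
  induction p using MvPolynomial.induction_on with
  | C a =>
    refine ⟨0, 0, ?_, ?_, ?_, ?_⟩
    · have : π (C a) = a • (1 : A) := by
        rw [← Algebra.algebraMap_eq_smul_one]; exact π.commutes a
      simp [this, TensorProduct.smul_tmul]
    · simp
    · simp
    · simp
  | add p p' hp hp' =>
    obtain ⟨c, q, h1, h2, h3, h4⟩ := hp
    obtain ⟨c', q', h1', h2', h3', h4'⟩ := hp'
    refine ⟨c + c', q + q', ?_, ?_, ?_, ?_⟩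
    · simp only [map_add, Pi.add_apply, add_mul, Finset.sum_add_distrib, ← h1, ← h1',
        TensorProduct.add_tmul, TensorProduct.tmul_add]
      abel
    · intro t; simp [h2, h2']
    · conv_lhs => rw [h3, h3']
      simp only [map_add, Pi.add_apply, add_mul, Finset.sum_add_distrib]
      abel
    · intro t; simp only [Pi.add_apply, map_add, h4, h4']
  | mul_X p s hp =>
    obtain ⟨c, q, h1, h2, h3, h4⟩ := hp
    -- From `p(x) x_s - p(y) y_s = (p(x) - p(y)) x_s + p(y) (x_s - y_s)`.
    refine ⟨fun t => c t * (π (X s) ⊗ₜ[K] 1) + if t = s then 1 ⊗ₜ[K] π p else 0,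
      fun t => if t = s then p else 0, ?_, ?_, ?_, ?_⟩
    · have h5 : ∑ t, (c t * (π (X s) ⊗ₜ[K] 1) + if t = s then 1 ⊗ₜ[K] π p else 0) *
          (π (X t) ⊗ₜ[K] 1 - 1 ⊗ₜ[K] π (X t)) =
          (∑ t, c t * (π (X t) ⊗ₜ[K] 1 - 1 ⊗ₜ[K] π (X t))) * (π (X s) ⊗ₜ[K] 1) +
          (1 ⊗ₜ[K] π p) * (π (X s) ⊗ₜ[K] 1 - 1 ⊗ₜ[K] π (X s)) := by
        simp only [add_mul, Finset.sum_add_distrib, ite_mul, zero_mul, Finset.sum_ite_eq',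
          Finset.mem_univ, if_true]
        congr 1
        rw [Finset.sum_mul]
        exact Finset.sum_congr rfl fun t _ => by ring
      rw [h5, ← h1]
      simp only [map_mul, sub_mul, mul_sub, Algebra.TensorProduct.tmul_mul_tmul, mul_one, one_mul]
      abel
    · intro t
      have h6 : ∀ x y : A ⊗[K] A, LinearMap.mul' K A (x * y) =
          LinearMap.mul' K A x * LinearMap.mul' K A y := fun x y =>
        map_mul (Algebra.TensorProduct.lmul' (S := A) K) x y
      rw [map_add, h6, h2, Derivation.leibniz, pderiv_X]
      by_cases h : t = s
      · subst h; simp; ring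
      · simp [h, Ne.symm h]; ring
    · simp
    · intro t
      rw [map_add, contractLeft_algHom_mul]
      have : contractLeft ε.toLinearMap (π (X s) ⊗ₜ[K] (1 : A)) = 0 := by
        rw [contractLeft_tmul, AlgHom.toLinearMap_apply, hε, zero_smul]
      rw [this, mul_zero, zero_add]
      by_cases h : t = s <;> simp [h]

end DifferenceQuotient

/-- The determinant expressing a regular sequence of length two in terms of a sequence `s, t` with
`s` prime does not belong to the ideal of the regular sequence. -/
theorem det_notMem_span_pair {O : Type*} [CommRing O] [IsDomain O] [IsLocalRing O]
    {s t f g T₁₁ T₁₂ T₂₁ T₂₂ : O} (hs : Prime s) (ht : ¬ IsUnit t)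
    (hf : f = T₁₁ * s + T₁₂ * t) (hg : g = T₂₁ * s + T₂₂ * t)
    (hreg : ∀ x y, f * x = g * y → g ∣ x ∧ f ∣ y) :
    T₁₁ * T₂₂ - T₁₂ * T₂₁ ∉ Ideal.span {f, g} := by
  intro hmem
  obtain ⟨a, b, hab⟩ := Ideal.mem_span_pair.mp hmem
  have hunit : ∀ c, IsUnit (1 + c * t) := fun c => by
    by_contra h
    have h1 : (1 + c * t) - c * t ∈ IsLocalRing.maximalIdeal O :=
      Ideal.sub_mem _ ((IsLocalRing.mem_maximalIdeal _).mpr h)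
        (Ideal.mul_mem_left _ _ ((IsLocalRing.mem_maximalIdeal _).mpr ht))
    rw [add_sub_cancel_right] at h1
    exact (Ideal.ne_top_iff_one _).mp (IsLocalRing.maximalIdeal.isMaximal O).ne_top h1
  -- By Cramer's rule `det · s = T₂₂ f - T₁₂ g`. Regularity then makes `a s - T₂₂` a multiple of `g`
  -- and `b s + T₁₂` a multiple of `f`; modulo `s` this forces `s ∣ T₂₂` and `s ∣ T₁₂`. So `s`
  -- divides both `f` and `g`, which contradicts regularity.
  have h1 : f * (a * s - T₂₂) = g * (-(b * s + T₁₂)) := by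
    linear_combination s * hab + (T₂₂) * hf * (-1) + T₁₂ * hg
  obtain ⟨⟨c, hc⟩, ⟨d, hd⟩⟩ := hreg _ _ h1
  have h2 : s ∣ T₂₂ := by
    have : s ∣ (1 + c * t) * T₂₂ := ⟨a - c * T₂₁, by linear_combination -hc + c * hg * (-1)⟩
    exact (hs.dvd_or_dvd this).resolve_left fun h => hs.not_isUnit (isUnit_of_dvd_unit h (hunit c))
  have h3 : s ∣ T₁₂ := by
    have : s ∣ (1 + d * t) * T₁₂ := ⟨-b - d * T₁₁, by linear_combination -hd - d * hf⟩
    exact (hs.dvd_or_dvd this).resolve_left fun h => hs.not_isUnit (isUnit_of_dvd_unit h (hunit d))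
  have hfs : s ∣ f := hf ▸ dvd_add (dvd_mul_left _ _) (h3.mul_right _)
  have hgs : s ∣ g := hg ▸ dvd_add (dvd_mul_left _ _) (h2.mul_right _)
  obtain ⟨f', hf'⟩ := hfs
  obtain ⟨g', hg'⟩ := hgs
  have h4 : f * g' = g * f' := by rw [hf', hg']; ring
  obtain ⟨⟨u, hu⟩, -⟩ := hreg _ _ h4
  have h5 : g' * (1 - s * u) = 0 := by
    rw [hg'] at hu
    linear_combination hu
  rcases mul_eq_zero.mp h5 with h | h
  · have hg0 : g = 0 := by rw [hg', h, mul_zero]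
    have := (hreg 0 1 (by rw [hg0]; ring)).2
    exact hs.not_isUnit (isUnit_of_dvd_one ((Dvd.intro _ hf'.symm : s ∣ f).trans this))
  · exact hs.not_isUnit (IsUnit.of_mul_eq_one u (by linear_combination -h))

theorem exists_prime_dvd_mem {R : Type*} [CommRing R] [IsDomain R] [UniqueFactorizationMonoid R]
    {P : Ideal R} [hP : P.IsPrime] {d : R} (hd : d ≠ 0) (hdP : d ∈ P) :
    ∃ π, Prime π ∧ π ∣ d ∧ π ∈ P := by
  obtain ⟨u, hu⟩ := UniqueFactorizationMonoid.factors_prod hd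
  have h1 : (UniqueFactorizationMonoid.factors d).prod ∈ P := by
    rw [← hu] at hdP
    exact (hP.mem_or_mem hdP).resolve_right fun h => hP.ne_top (Ideal.eq_top_of_isUnit_mem _ h u.isUnit)
  obtain ⟨π, hπ, hπP⟩ := (hP.multiset_prod_mem_iff_exists_mem _).mp h1
  exact ⟨π, UniqueFactorizationMonoid.prime_of_factor _ hπ,
    UniqueFactorizationMonoid.dvd_of_mem_factors hπ, hπP⟩

theorem exists_eq_mul_isRelPrime {R : Type*} [CommRing R] [IsDomain R]
    [UniqueFactorizationMonoid R] (f g : R) :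
    ∃ d f' g', IsRelPrime f' g' ∧ f = d * f' ∧ g = d * g' := by
  by_cases hf : f = 0
  · exact ⟨g, 0, 1, isRelPrime_one_right, by simp [hf], by simp⟩
  · obtain ⟨f', g', d, h, h1, h2⟩ := UniqueFactorizationMonoid.exists_reduced_factors f hf g
    exact ⟨d, f', g', h, h1.symm, h2.symm⟩

/-! ### The Jacobian at an isolated zero in two variables -/

section TwoVariables

variable {K T : Type*} [Field K]

/-- If the common factor vanished at the origin, so would one of its prime factors; that prime would
divide both `X s` and `X t`. -/
theorem exists_eq_mul_isRelPrime_of_mem_span {f g : MvPolynomial T K} {s t : T} (hst : s ≠ t)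
    (hs : ∃ (u : MvPolynomial T K) (a : ℕ), constantCoeff u ≠ 0 ∧
      u * X s ^ a ∈ Ideal.span {f, g})
    (ht : ∃ (u : MvPolynomial T K) (a : ℕ), constantCoeff u ≠ 0 ∧
      u * X t ^ a ∈ Ideal.span {f, g}) :
    ∃ d f' g', IsRelPrime f' g' ∧ f = d * f' ∧ g = d * g' ∧ constantCoeff d ≠ 0 := by
  obtain ⟨d, f', g', hrel, rfl, rfl⟩ := exists_eq_mul_isRelPrime f g
  refine ⟨d, f', g', hrel, rfl, rfl, fun hd0 => ?_⟩
  have hle : Ideal.span {d * f', d * g'} ≤ Ideal.span {d} := by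
    rw [Ideal.span_le]
    rintro x (rfl | rfl)
    · exact Ideal.mul_mem_right _ _ (Ideal.mem_span_singleton_self d)
    · exact Ideal.mul_mem_right _ _ (Ideal.mem_span_singleton_self d)
  have hP : (RingHom.ker (constantCoeff (R := K) (σ := T))).IsPrime := RingHom.ker_isPrime _
  have hdvd : ∀ π : MvPolynomial T K, Prime π → π ∣ d → constantCoeff π = 0 → ∀ r,
      (∃ (u : MvPolynomial T K) (a : ℕ), constantCoeff u ≠ 0 ∧
        u * X r ^ a ∈ Ideal.span {d * f', d * g'}) → π ∣ X r := by
    rintro π hπ hπd hπ0 r ⟨u, a, hu, hmem⟩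
    have h1 : π ∣ u * X r ^ a := hπd.trans (Ideal.mem_span_singleton.mp (hle hmem))
    refine hπ.dvd_of_dvd_pow ((hπ.dvd_or_dvd h1).resolve_left ?_)
    rintro ⟨v, rfl⟩
    exact hu (by simp [hπ0])
  have hd : d ≠ 0 := by
    rintro rfl
    obtain ⟨u, a, hu, hmem⟩ := hs
    have h1 := hle hmem
    simp only [Ideal.mem_span_singleton, zero_dvd_iff, mul_eq_zero, pow_eq_zero_iff', X_ne_zero,
      false_and, or_false] at h1
    exact hu (by simp [h1])
  obtain ⟨π, hπ, hπd, hπ0⟩ := exists_prime_dvd_mem hd ((RingHom.mem_ker (f := constantCoeff)).mpr hd0)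
  have h1 := hdvd π hπ hπd hπ0 s hs
  have h2 := hdvd π hπ hπd hπ0 t ht
  have h3 : X s ∣ (X t : MvPolynomial T K) :=
    ((hπ.irreducible.associated_of_dvd X_prime.irreducible h1).symm.dvd).trans h2
  rw [MvPolynomial.X_dvd_X] at h3
  simp_all

/-- In two variables over a field of characteristic zero, the Jacobian of a pair `f, g` with an
isolated zero at the origin does not belong locally to the ideal `(f, g)`. -/
theorem mul_jacobian_notMem_span_pair [CharZero K] [Fintype T] [DecidableEq T] {s t : T} (hst : s ≠ t)
    (hT : ∀ r, r = s ∨ r = t) {f g : MvPolynomial T K}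
    (hf : constantCoeff f = 0) (hg : constantCoeff g = 0)
    (hfin : ∀ r, ∃ (u : MvPolynomial T K) (a : ℕ), constantCoeff u ≠ 0 ∧
      u * X r ^ a ∈ Ideal.span {f, g})
    {v : MvPolynomial T K} (hv : constantCoeff v ≠ 0) :
    v * (pderiv s f * pderiv t g - pderiv t f * pderiv s g) ∉ Ideal.span {f, g} := by
  intro hmem
  have huniv : (Finset.univ : Finset T) = {s, t} := by
    ext r; simpa using hT r
  let m : Ideal (MvPolynomial T K) := RingHom.ker (constantCoeff (R := K) (σ := T))
  have hm : ∀ p, p ∈ m ↔ constantCoeff p = 0 := fun p => RingHom.mem_ker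
  have hP : m.IsPrime := RingHom.ker_isPrime _
  let O := Localization.AtPrime m
  have hinj : Function.Injective (algebraMap (MvPolynomial T K) O) :=
    IsLocalization.injective O m.primeCompl_le_nonZeroDivisors
  have hdom : IsDomain O := IsLocalization.isDomain_localization m.primeCompl_le_nonZeroDivisors
  have hunit : ∀ p, IsUnit (algebraMap (MvPolynomial T K) O p) ↔ constantCoeff p ≠ 0 := fun p => by
    rw [IsLocalization.AtPrime.isUnit_to_map_iff O m]; exact Iff.rfl
  set φ := algebraMap (MvPolynomial T K) O with hφ
  -- The quotient by `𝔞` plays the role of the local ring of `(f, g)` at the origin. It is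
  -- finite-dimensional because the coordinates become nilpotent in it.
  let 𝔞 : Ideal (MvPolynomial T K) := (Ideal.span {φ f, φ g}).comap φ
  have h𝔞 : ∀ (u p : MvPolynomial T K), constantCoeff u ≠ 0 → u * p ∈ Ideal.span {f, g} → p ∈ 𝔞 := by
    intro u p hu hup
    rw [Ideal.mem_comap]
    have h1 := Ideal.mem_map_of_mem φ hup
    rw [Ideal.map_span, Set.image_pair, map_mul] at h1
    exact (Ideal.unit_mul_mem_iff_mem _ ((hunit u).mpr hu)).mp h1
  have h𝔞m : 𝔞 ≤ m := by
    intro p hp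
    rw [Ideal.mem_comap] at hp
    by_contra h
    have h1 : IsUnit (φ p) := (hunit p).mpr h
    have h2 : Ideal.span {φ f, φ g} ≤ IsLocalRing.maximalIdeal O := by
      rw [Ideal.span_le]
      rintro x (rfl | rfl)
      · exact (IsLocalRing.mem_maximalIdeal _).mpr fun h => (hunit f).mp h hf
      · exact (IsLocalRing.mem_maximalIdeal _).mpr fun h => (hunit g).mp h hg
    exact (IsLocalRing.mem_maximalIdeal _).mp (h2 hp) h1
  let A := MvPolynomial T K ⧸ 𝔞
  let π : MvPolynomial T K →ₐ[K] A := Ideal.Quotient.mkₐ K 𝔞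
  have hπ0 : ∀ p, π p = 0 ↔ p ∈ 𝔞 := fun p => Ideal.Quotient.eq_zero_iff_mem
  have hπs : Function.Surjective π := Ideal.Quotient.mkₐ_surjective K 𝔞
  let ε : A →ₐ[K] K := Ideal.Quotient.liftₐ 𝔞 (aeval (0 : T → K)) (fun p hp => by
    have := (hm p).mp (h𝔞m hp)
    simpa [MvPolynomial.aeval_zero] using this)
  have hε : ∀ p, ε (π p) = constantCoeff p := fun p => by
    change aeval (0 : T → K) p = _
    simp [MvPolynomial.aeval_zero]
  have hnilX : ∀ r, IsNilpotent (π (X r)) := by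
    intro r
    obtain ⟨u, a, hu, hua⟩ := hfin r
    exact ⟨a, by rw [← map_pow, hπ0]; exact h𝔞 u _ hu hua⟩
  have hint : Algebra.IsIntegral K A := by
    refine ⟨fun a => ?_⟩
    obtain ⟨p, rfl⟩ := hπs a
    induction p using MvPolynomial.induction_on with
    | C c => exact isIntegral_algebraMap (R := K) (A := A) (x := c)
    | add p q hp hq => rw [map_add]; exact hp.add hq
    | mul_X p r hp =>
      rw [map_mul]
      refine hp.mul ?_
      obtain ⟨a, ha⟩ := hnilX r
      exact ⟨Polynomial.X ^ a, Polynomial.monic_X_pow a, by simp [ha]⟩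
  have hft : Algebra.FiniteType K A := Algebra.FiniteType.of_surjective π hπs
  have hfd : Module.Finite K A := Algebra.IsIntegral.finite
  have hker : IsNilpotent (RingHom.ker ε) := by
    have hnoeth : IsNoetherianRing A := inferInstanceAs (IsNoetherianRing (MvPolynomial T K ⧸ 𝔞))
    rw [Ideal.FG.isNilpotent_iff_le_nilradical (IsNoetherian.noetherian _)]
    intro a ha
    obtain ⟨p, rfl⟩ := hπs a
    rw [RingHom.mem_ker, hε] at ha
    obtain ⟨-, q, -, -, h3, -⟩ := exists_difference_quotient π ε (fun t => by simp [hε]) p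
    rw [h3, ha, map_zero, zero_add, map_sum]
    refine Ideal.sum_mem _ fun r _ => ?_
    rw [map_mul]
    exact Ideal.mul_mem_left _ _ (mem_nilradical.mpr (hnilX r))
  obtain ⟨cf, qf, hf1, hf2, hf3, hf4⟩ := exists_difference_quotient π ε (fun t => by simp [hε]) f
  obtain ⟨cg, qg, hg1, hg2, hg3, hg4⟩ := exists_difference_quotient π ε (fun t => by simp [hε]) g
  have hπf : π f = 0 := (hπ0 f).mpr (Ideal.mem_comap.mpr (Ideal.subset_span (by simp)))
  have hπg : π g = 0 := (hπ0 g).mpr (Ideal.mem_comap.mpr (Ideal.subset_span (by simp)))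
  rw [huniv, Finset.sum_pair hst] at hf1 hf3 hg1 hg3
  rw [hπf, TensorProduct.zero_tmul, TensorProduct.tmul_zero, sub_zero] at hf1
  rw [hπg, TensorProduct.zero_tmul, TensorProduct.tmul_zero, sub_zero] at hg1
  rw [hf, map_zero, zero_add] at hf3
  rw [hg, map_zero, zero_add] at hg3
  have hmul : ∀ x y : A ⊗[K] A, LinearMap.mul' K A (x * y) =
      LinearMap.mul' K A x * LinearMap.mul' K A y := fun x y =>
    map_mul (Algebra.TensorProduct.lmul' (S := A) K) x y
  -- The element is the determinant of the divided differences of `f` and `g`. Both vanish in `A`,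
  -- so Cramer's rule shows that it is killed by each `x_r - y_r`. The augmentation sends it to the
  -- determinant of `det_notMem_span_pair`, and multiplication sends it to the Jacobian.
  refine mul'_ne_zero_of_diagonal ε hker (cf s * cg t - cf t * cg s) ?_ ?_ ?_
  · intro a
    obtain ⟨p, rfl⟩ := hπs a
    induction p using MvPolynomial.induction_on with
    | C c =>
      have : π (C c) = c • (1 : A) := by
        rw [← Algebra.algebraMap_eq_smul_one]; exact π.commutes c
      rw [this, TensorProduct.smul_tmul]
    | add p q hp hq =>
      rw [map_add, TensorProduct.add_tmul, TensorProduct.tmul_add, add_mul, add_mul, hp, hq]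
    | mul_X p r hp =>
      have hX : (π (X r) ⊗ₜ[K] 1) * (cf s * cg t - cf t * cg s) =
          (1 ⊗ₜ[K] π (X r)) * (cf s * cg t - cf t * cg s) := by
        rcases hT r with rfl | rfl
        · linear_combination (-cg t) * hf1 + cf t * hg1
        · linear_combination (cg s) * hf1 - cf s * hg1
      have h1 : π (p * X r) ⊗ₜ[K] (1 : A) = (π p ⊗ₜ[K] 1) * (π (X r) ⊗ₜ[K] 1) := by simp
      have h2 : (1 : A) ⊗ₜ[K] π (p * X r) = (1 ⊗ₜ[K] π p) * (1 ⊗ₜ[K] π (X r)) := by simp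
      rw [h1, h2, mul_assoc, hX, mul_left_comm, hp]
      ring
  · rw [map_sub, contractLeft_algHom_mul, contractLeft_algHom_mul, hf4, hf4, hg4, hg4,
      ← map_mul, ← map_mul, ← map_sub, Ne, hπ0, Ideal.mem_comap, map_sub, map_mul, map_mul]
    refine det_notMem_span_pair (s := φ (X s)) (t := φ (X t)) ?_ ?_ ?_ ?_ ?_
    · have h1 : (Ideal.span {X s} : Ideal (MvPolynomial T K)).IsPrime :=
        (Ideal.span_singleton_prime (X_ne_zero s)).mpr ((X_prime : Prime (X s : MvPolynomial T K)))
      have h2 := IsLocalization.isPrime_of_isPrime_disjoint m.primeCompl O _ h1 (by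
        rw [Set.disjoint_left]
        intro p hp hp'
        obtain ⟨q, rfl⟩ := Ideal.mem_span_singleton.mp hp'
        exact hp ((hm _).mpr (by simp)))
      rw [Ideal.map_span, Set.image_singleton] at h2
      exact (Ideal.span_singleton_prime
        ((map_ne_zero_iff _ hinj).mpr (X_ne_zero s))).mp h2
    · rw [hunit]; simp
    · rw [← map_mul, ← map_mul, ← map_add, ← hf3]
    · rw [← map_mul, ← map_mul, ← map_add, ← hg3]
    -- The common factor is a unit at the origin, so regularity in the local ring follows from
    -- coprimality of the polynomials `f'` and `g'`.
    · obtain ⟨d, f', g', hrel, hdf, hdg, hd⟩ :=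
        exists_eq_mul_isRelPrime_of_mem_span hst (hfin s) (hfin t)
      have hdu := (hunit d).mpr hd
      intro x y hxy
      obtain ⟨x', y', w, hx, hy⟩ := IsLocalization.surj₂ m.primeCompl O x y
      have hwu : IsUnit (φ w) := IsLocalization.map_units O w
      have h1 : f * x' = g * y' := by
        apply hinj
        rw [map_mul, map_mul, ← hx, ← hy]
        linear_combination (φ w) * hxy
      have hd0 : d ≠ 0 := fun h => hd (by simp [h])
      have h2 : f' * x' = g' * y' := by
        apply mul_left_cancel₀ hd0
        rw [← mul_assoc, ← mul_assoc, ← hdf, ← hdg, h1]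
      have h3 : g' ∣ x' := hrel.symm.dvd_of_dvd_mul_left ⟨y', h2⟩
      have h4 : f' ∣ y' := hrel.dvd_of_dvd_mul_left ⟨x', h2.symm⟩
      have h5 := map_dvd φ h3
      have h6 := map_dvd φ h4
      rw [← hx, hwu.dvd_mul_right] at h5
      rw [← hy, hwu.dvd_mul_right] at h6
      rw [hdf, hdg, map_mul, map_mul, hdu.mul_left_dvd, hdu.mul_left_dvd]
      exact ⟨h5, h6⟩
  · rw [map_sub, hmul, hmul, hf2, hf2, hg2, hg2, ← map_mul, ← map_mul, ← map_sub, hπ0]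
    exact h𝔞 v _ hv hmem

end TwoVariables

/-! ### Minimal primes and heights -/

/-- After localising at `q`, it is the only prime over `I`, so its elements are nilpotent modulo
`I`. -/
theorem exists_mul_pow_mem_of_mem_minimalPrimes {R : Type*} [CommRing R] {I q : Ideal R}
    (hq : q ∈ I.minimalPrimes) {x : R} (hx : x ∈ q) : ∃ y ∉ q, ∃ n : ℕ, y * x ^ n ∈ I := by
  have hqp : q.IsPrime := hq.1.1
  by_contra! hcon
  obtain ⟨P, hP, hIP, hdisj⟩ := Ideal.exists_le_prime_disjoint I
    (q.primeCompl ⊔ Submonoid.powers x) (by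
      rw [Set.disjoint_left]
      intro z hz hz'
      obtain ⟨y, hy, w, ⟨n, rfl⟩, rfl⟩ := Submonoid.mem_sup.mp hz'
      exact hcon y hy n hz)
  have h1 : P ≤ q := by
    intro z hz
    by_contra h
    exact Set.disjoint_left.mp hdisj hz (Submonoid.mem_sup_left h)
  exact Set.disjoint_left.mp hdisj (hq.2 ⟨hP, hIP⟩ h1 hx)
    (Submonoid.mem_sup_right (Submonoid.mem_powers x))

theorem two_le_height_of_isRelPrime {R : Type*} [CommRing R] [IsDomain R]
    [UniqueFactorizationMonoid R] {f g : R} (hfg : IsRelPrime f g) {q : Ideal R} [q.IsPrime]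
    (hf : f ∈ q) (hg : g ∈ q) : 2 ≤ q.height := by
  have hf0 : f ≠ 0 := by
    rintro rfl
    exact Ideal.IsPrime.ne_top ‹_› (Ideal.eq_top_of_isUnit_mem _ hg (isRelPrime_zero_left.mp hfg))
  obtain ⟨π, hπ, hπf, hπq⟩ := exists_prime_dvd_mem hf0 hf
  have hprime : (Ideal.span {π}).IsPrime := (Ideal.span_singleton_prime hπ.ne_zero).mpr hπ
  have h1 : (⊥ : Ideal R) < Ideal.span {π} := by
    rw [bot_lt_iff_ne_bot, Ne, Ideal.span_singleton_eq_bot]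
    exact hπ.ne_zero
  have h2 : Ideal.span {π} < q := by
    refine lt_of_le_of_ne ((Ideal.span_singleton_le_iff_mem _).mpr hπq) ?_
    rintro rfl
    exact hπ.not_isUnit (hfg hπf (Ideal.mem_span_singleton.mp hg))
  calc (2 : ℕ∞) = 0 + 1 + 1 := by norm_num
    _ ≤ (⊥ : Ideal R).height + 1 + 1 := by gcongr; exact zero_le
    _ ≤ (Ideal.span {π}).height + 1 := by
      gcongr; exact Ideal.height_add_one_le_of_lt_of_isPrime h1
    _ ≤ q.height := Ideal.height_add_one_le_of_lt_of_isPrime h2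

/-- Setting the coordinates to zero one after the other gives a strict chain of prime kernels. -/
theorem card_le_height_ker_constantCoeff (K T : Type*) [Field K] [Fintype T] :
    (Fintype.card T : ℕ∞) ≤ (RingHom.ker (constantCoeff (R := K) (σ := T))).height := by
  classical
  let ev : Finset T → MvPolynomial T K →ₐ[K] MvPolynomial T K := fun s =>
    aeval fun t => if t ∈ s then 0 else X t
  have hprime : ∀ s, (RingHom.ker (ev s)).IsPrime := fun s => RingHom.ker_isPrime _
  have key : ∀ s : Finset T, (s.card : ℕ∞) ≤ (RingHom.ker (ev s)).height := by
    intro s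
    induction s using Finset.induction_on with
    | empty => simp
    | insert a s ha ih =>
      rw [Finset.card_insert_of_notMem ha, Nat.cast_add, Nat.cast_one]
      refine le_trans (add_le_add_left ih 1) (Ideal.height_add_one_le_of_lt_of_isPrime ?_)
      refine lt_of_le_of_ne ?_ ?_
      · intro p hp
        rw [RingHom.mem_ker] at hp ⊢
        have hcomp : (ev (insert a s)) = (ev {a}).comp (ev s) := by
          ext t
          by_cases h : t ∈ s
          · simp [ev, h]
          · simp [ev, h]
        rw [hcomp, AlgHom.comp_apply, hp, map_zero]
      · intro h
        have h1 : X a ∈ RingHom.ker (ev (insert a s)) := by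
          rw [RingHom.mem_ker]; simp [ev]
        rw [← h, RingHom.mem_ker] at h1
        simp [ev, ha] at h1
  have h1 : RingHom.ker (ev Finset.univ) = RingHom.ker (constantCoeff (R := K) (σ := T)) := by
    ext p
    rw [RingHom.mem_ker, RingHom.mem_ker]
    have : ev Finset.univ p = C (constantCoeff p) := by
      induction p using MvPolynomial.induction_on with
      | C a => simp [ev]
      | add p q hp hq => rw [map_add, map_add, map_add, hp, hq]
      | mul_X p t hp => simp [ev]
    rw [this, map_eq_zero_iff _ (C_injective T K)]
  rw [← h1, ← Finset.card_univ]
  exact key _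

/-! ### Slices through a generic point -/

section Slice

variable {k τ K : Type*} [Field k] [Field K] [Algebra k K] (ξ : τ → K) (B : Set τ)

open Classical in
/-- Restriction of a polynomial to the slice through the point `ξ` on which the coordinates in `B`
are fixed, with the other coordinates centered at `ξ`. -/
noncomputable def slice : MvPolynomial τ k →ₐ[k] MvPolynomial {t // t ∉ B} K :=
  aeval fun t => if h : t ∈ B then C (ξ t) else C (ξ t) + X ⟨t, h⟩

theorem constantCoeff_slice (p : MvPolynomial τ k) : constantCoeff (slice ξ B p) = aeval ξ p := by
  induction p using MvPolynomial.induction_on with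
  | C a =>
    rw [slice, aeval_C, aeval_C]
    rw [IsScalarTower.algebraMap_apply k K (MvPolynomial {t // t ∉ B} K), algebraMap_eq,
      constantCoeff_C]
  | add p q hp hq => simp [hp, hq]
  | mul_X p t hp =>
    rw [map_mul, map_mul, map_mul, hp, slice, aeval_X, aeval_X]
    by_cases h : t ∈ B <;> simp [h]

theorem pderiv_slice (r : {t // t ∉ B}) (p : MvPolynomial τ k) :
    pderiv r (slice ξ B p) = slice ξ B (pderiv r.1 p) := by
  classical
  induction p using MvPolynomial.induction_on with
  | C a =>
    rw [pderiv_C, map_zero, slice, aeval_C,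
      IsScalarTower.algebraMap_apply k K (MvPolynomial {t // t ∉ B} K), algebraMap_eq, pderiv_C]
  | add p q hp hq => simp [hp, hq]
  | mul_X p t hp =>
    rw [map_mul, Derivation.leibniz, hp, Derivation.leibniz, map_add, smul_eq_mul, smul_eq_mul,
      smul_eq_mul, smul_eq_mul, map_mul, map_mul]
    congr 2
    rw [slice, aeval_X, pderiv_X]
    by_cases h : t ∈ B
    · have : r.1 ≠ t := fun h' => r.2 (h' ▸ h)
      simp [h, this.symm]
    · by_cases h' : t = r.1
      · subst h'; simp [h]
      · have : (⟨t, h⟩ : {t // t ∉ B}) ≠ r := fun h'' => h' (by rw [← h''])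
        simp [h, h', this]

theorem slice_rename (d : MvPolynomial B k) :
    slice ξ B (rename (↑) d) = C (aeval (fun b : B => ξ b) d) := by
  induction d using MvPolynomial.induction_on with
  | C a =>
    rw [rename_C, slice, aeval_C, aeval_C,
      IsScalarTower.algebraMap_apply k K (MvPolynomial {t // t ∉ B} K), algebraMap_eq]
  | add p q hp hq => simp [hp, hq]
  | mul_X p t hp =>
    rw [map_mul, map_mul, hp, map_mul, map_mul, rename_X, aeval_X, slice, aeval_X]
    simp

/-- Clear an algebraic equation of `ξ t` over the coordinates in `B` to a polynomial `p`. On the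
slice `p` depends only on the coordinate at `t` and vanishes at the origin, so it is a power of that
coordinate times a local unit. This makes the coordinate nilpotent modulo the equations. -/
theorem exists_slice_eq_mul_pow {t : τ} (ht : t ∉ B)
    (halg : IsAlgebraic (Algebra.adjoin k (ξ '' B)) (ξ t)) :
    ∃ (p : MvPolynomial τ k) (u : MvPolynomial {t // t ∉ B} K) (a : ℕ), aeval ξ p = 0 ∧
      constantCoeff u ≠ 0 ∧ slice ξ B p = u * X ⟨t, ht⟩ ^ a := by
  classical
  obtain ⟨P, hP0, hP⟩ := halg
  have hlift : ∀ c : Algebra.adjoin k (ξ '' B), ∃ d : MvPolynomial B k,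
      aeval (fun b : B => ξ b) d = (c : K) := by
    intro c
    have h1 : Algebra.adjoin k (ξ '' B) = (aeval fun b : B => ξ b).range := by
      rw [Set.image_eq_range, Algebra.adjoin_range_eq_range_aeval]
    exact (h1.le c.2 :)
  choose d hd using hlift
  let p : MvPolynomial τ k := ∑ i ∈ P.support, rename (↑) (d (P.coeff i)) * X t ^ i
  let Q : Polynomial K := P.map (algebraMap _ K)
  have hQ0 : Q ≠ 0 := by
    rwa [Ne, Polynomial.map_eq_zero_iff Subtype.val_injective]
  have hQt0 : Polynomial.taylor (ξ t) Q ≠ 0 := by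
    rwa [Ne, Polynomial.taylor_eq_zero]
  obtain ⟨U, hU, hndvd⟩ := Polynomial.exists_eq_pow_rootMultiplicity_mul_and_not_dvd _ hQt0 0
  have hslice : slice ξ B p = Polynomial.aeval (X ⟨t, ht⟩) (Polynomial.taylor (ξ t) Q) := by
    have h1 : Polynomial.aeval (X ⟨t, ht⟩ : MvPolynomial {t // t ∉ B} K)
        (Polynomial.taylor (ξ t) Q) = Polynomial.aeval (C (ξ t) + X ⟨t, ht⟩) Q := by
      rw [Polynomial.taylor_apply, Polynomial.aeval_comp]
      congr 1
      simp [add_comm, algebraMap_eq]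
    rw [h1, Polynomial.aeval_def, Polynomial.eval₂_map, Polynomial.eval₂_eq_sum,
      Polynomial.sum_def, map_sum]
    refine Finset.sum_congr rfl fun i _ => ?_
    rw [map_mul, map_pow, slice_rename, hd]
    congr 1
    simp [slice, ht]
  have hconst : ∀ V : Polynomial K,
      constantCoeff (Polynomial.aeval (X ⟨t, ht⟩ : MvPolynomial {t // t ∉ B} K) V) = V.eval 0 := by
    intro V
    rw [Polynomial.aeval_def, Polynomial.hom_eval₂, constantCoeff_X]
    have : (constantCoeff (R := K) (σ := {t // t ∉ B})).comp (algebraMap K _) = RingHom.id K := by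
      ext x; simp [algebraMap_eq]
    rw [this, Polynomial.eval₂_id]
  refine ⟨p, Polynomial.aeval (X ⟨t, ht⟩) U, (Polynomial.taylor (ξ t) Q).rootMultiplicity 0,
    ?_, ?_, ?_⟩
  · rw [← constantCoeff_slice ξ B, hslice, hconst, Polynomial.taylor_eval, zero_add]
    rw [Polynomial.eval_map_algebraMap]
    exact hP
  · rw [hconst]
    intro h
    exact hndvd (by simpa using Polynomial.dvd_iff_isRoot.mpr h)
  · rw [hslice]
    conv_lhs => rw [hU]
    simp [mul_comm]

end Slice

/-- If the coordinates in `B` are algebraically independent modulo the prime `q`, then the height of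
`q` is at most the number of remaining coordinates. -/
theorem height_le_card_of_algebraicIndepOn {k τ K : Type*} [Field k] [Fintype τ] [Field K]
    [Algebra k K] {ξ : τ → K} {q : Ideal (MvPolynomial τ k)} [hqp : q.IsPrime]
    (hq : ∀ p, p ∈ q → aeval ξ p = 0) {B : Set τ} (hB : AlgebraicIndepOn k ξ B) :
    q.height ≤ Nat.card {t // t ∉ B} := by
  classical
  let D := MvPolynomial B k
  let e : MvPolynomial τ k ≃ₐ[k] MvPolynomial {t // t ∉ B} D :=
    (renameEquiv k ((Equiv.sumCompl (· ∈ B)).symm.trans (Equiv.sumComm _ _))).trans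
      (sumAlgEquiv k {t // t ∉ B} B)
  let q' : Ideal (MvPolynomial {t // t ∉ B} D) := q.comap (e.symm : _ →+* _)
  have hq'p : q'.IsPrime := Ideal.comap_isPrime _ _
  have hht : q'.height = q.height := RingEquiv.height_comap e.symm.toRingEquiv q
  -- No nonzero polynomial in the variables of `B` lies in `q`, so inverting all of them preserves
  -- the height. The result is a polynomial ring over a field, whose dimension is the number of
  -- remaining variables.
  let M := (nonZeroDivisors D).map (C (σ := {t // t ∉ B}) (R := D))
  let : Algebra (MvPolynomial {t // t ∉ B} D) (MvPolynomial {t // t ∉ B} (FractionRing D)) :=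
    MvPolynomial.algebraMvPolynomial
  let L := MvPolynomial {t // t ∉ B} (FractionRing D)
  have hC : ∀ d : D, e.symm (C d) = rename (↑) d := by
    intro d
    rw [AlgEquiv.symm_apply_eq]
    induction d using MvPolynomial.induction_on with
    | C a =>
      rw [rename_C, AlgEquiv.trans_apply, renameEquiv_apply, rename_C]
      exact (sumAlgEquiv_C_inl k _ _ a).symm
    | add p q hp hq => simp only [map_add, hp, hq]
    | mul_X p t hp =>
      rw [map_mul, map_mul, map_mul, hp]
      congr 1
      rw [rename_X, AlgEquiv.trans_apply, renameEquiv_apply, rename_X]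
      have : ((Equiv.sumCompl (· ∈ B)).symm.trans (Equiv.sumComm _ _)) (t : τ) = Sum.inr t := by
        simp [Equiv.sumCompl_symm_apply_of_pos (p := (· ∈ B)) t.2]
      rw [this]
      exact (sumAlgEquiv_X_inr k _ _ t).symm
  have hdisj : Disjoint (M : Set (MvPolynomial {t // t ∉ B} D)) q' := by
    rw [Set.disjoint_left]
    rintro _ ⟨d, hd, rfl⟩ hd'
    have h1 : e.symm (C d) ∈ q := hd'
    rw [hC] at h1
    have h2 := hq _ h1
    rw [aeval_rename] at h2
    have h3 : d = 0 := by
      apply (algebraicIndependent_iff.mp hB) d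
      exact h2
    exact nonZeroDivisors.ne_zero hd h3
  have hloc : IsLocalization M L := inferInstance
  have h4 := IsLocalization.height_map_of_disjoint (S := L) M q' hdisj
  have hne : q'.map (algebraMap _ L) ≠ ⊤ :=
    (IsLocalization.isPrime_of_isPrime_disjoint M L q' hq'p hdisj).ne_top
  have h5 := Ideal.height_le_ringKrullDim_of_ne_top hne
  rw [MvPolynomial.ringKrullDim_of_isNoetherianRing, ringKrullDim_eq_zero_of_field, zero_add, h4,
    hht] at h5
  exact_mod_cast h5

/-- At a minimal prime `q` of a complete intersection `(f, g)` in characteristic zero, the `2 × 2`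
minors of the Jacobian matrix of `(f, g)` do not all belong to `(f, g)` locally. -/
theorem exists_mul_minor_notMem_span_pair {k τ : Type*} [Field k] [CharZero k] [Fintype τ]
    {f g : MvPolynomial τ k} (hfg : IsRelPrime f g) {q : Ideal (MvPolynomial τ k)}
    (hq : q ∈ (Ideal.span {f, g}).minimalPrimes) {h : MvPolynomial τ k} (hh : h ∉ q) :
    ∃ μ ν, h * (pderiv μ f * pderiv ν g - pderiv ν f * pderiv μ g) ∉ Ideal.span {f, g} := by
  classical
  have hqp : q.IsPrime := hq.1.1
  have hfq : f ∈ q := hq.1.2 (Ideal.subset_span (by simp))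
  have hgq : g ∈ q := hq.1.2 (Ideal.subset_span (by simp))
  let K := FractionRing (MvPolynomial τ k ⧸ q)
  have hchar : CharZero K := charZero_of_injective_algebraMap (algebraMap k K).injective
  let ξ : τ → K := fun t => algebraMap _ K (Ideal.Quotient.mk q (X t))
  have hξ : ∀ p, aeval ξ p = algebraMap (MvPolynomial τ k ⧸ q) K (Ideal.Quotient.mk q p) := by
    intro p
    induction p using MvPolynomial.induction_on with
    | C a =>
      rw [aeval_C, IsScalarTower.algebraMap_apply k (MvPolynomial τ k ⧸ q) K]
      rfl
    | add p q hp hq => simp only [map_add, hp, hq]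
    | mul_X p t hp => simp only [map_mul, hp, aeval_X, ξ]
  have hξq : ∀ p, aeval ξ p = 0 ↔ p ∈ q := by
    intro p
    rw [hξ, map_eq_zero_iff _ (IsFractionRing.injective _ _), Ideal.Quotient.eq_zero_iff_mem]
  -- `B` is a transcendence basis of the function field of `V(q)` chosen among the coordinates.
  -- Freezing these at their generic values isolates the generic point on the slice.
  obtain ⟨B, hB, hmax⟩ := (Set.toFinite {B : Set τ | AlgebraicIndepOn k ξ B}).exists_maximal
    ⟨∅, algebraicIndependent_empty_type_iff.mpr (algebraMap k K).injective⟩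
  have halg : ∀ t ∉ B, IsAlgebraic (Algebra.adjoin k (ξ '' B)) (ξ t) := by
    intro t ht
    by_contra hcon
    have h1 : AlgebraicIndepOn k ξ (insert t B) := (AlgebraicIndepOn.insert_iff ht).mpr ⟨hB, hcon⟩
    exact ht (hmax h1 (Set.subset_insert t B) (Set.mem_insert t B))
  have hmem : ∀ p ∈ Ideal.span {f, g}, slice ξ B p ∈ Ideal.span {slice ξ B f, slice ξ B g} := by
    intro p hp
    have h1 := Ideal.mem_map_of_mem (slice ξ B : MvPolynomial τ k →ₐ[k] _) hp
    rw [Ideal.map_span, Set.image_pair] at h1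
    exact h1
  have hconst : ∀ p, constantCoeff (slice ξ B p) = 0 ↔ p ∈ q := fun p => by
    rw [constantCoeff_slice, hξq]
  have hfin : ∀ r : {t // t ∉ B}, ∃ (u : MvPolynomial {t // t ∉ B} K) (a : ℕ),
      constantCoeff u ≠ 0 ∧ u * X r ^ a ∈ Ideal.span {slice ξ B f, slice ξ B g} := by
    rintro ⟨t, ht⟩
    obtain ⟨p, u, a, hp, hu, hpu⟩ := exists_slice_eq_mul_pow ξ B ht (halg t ht)
    obtain ⟨y, hy, n, hyn⟩ := exists_mul_pow_mem_of_mem_minimalPrimes hq ((hξq p).mp hp)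
    refine ⟨slice ξ B y * u ^ n, a * n, ?_, ?_⟩
    · rw [map_mul, map_pow]
      exact mul_ne_zero (fun h => hy ((hconst y).mp h)) (pow_ne_zero _ hu)
    · have h1 := hmem _ hyn
      rw [map_mul, map_pow, hpu] at h1
      convert h1 using 1
      ring
  -- The slice has exactly two coordinates. Its origin is a minimal prime over two elements, so
  -- Krull's height theorem gives `≤ 2`; coprimality of `f` and `g` gives height at least two for
  -- `q`, hence `≥ 2`.
  have hle : Fintype.card {t // t ∉ B} ≤ 2 := by
    let m := RingHom.ker (constantCoeff (R := K) (σ := {t // t ∉ B}))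
    have hmp : m.IsPrime := RingHom.ker_isPrime _
    have hmin : m ∈ (Ideal.span {slice ξ B f, slice ξ B g}).minimalPrimes := by
      refine ⟨⟨hmp, ?_⟩, ?_⟩
      · rw [Ideal.span_le]
        rintro x (rfl | rfl)
        · exact (hconst f).mpr hfq
        · exact (hconst g).mpr hgq
      · rintro P ⟨hP, hPle⟩ hPm p hp
        obtain ⟨-, c, -, -, h3, -⟩ := exists_difference_quotient
          (AlgHom.id K (MvPolynomial {t // t ∉ B} K)) (aeval 0) (by simp) p
        rw [h3, RingHom.mem_ker.mp hp, map_zero, zero_add]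
        refine Ideal.sum_mem _ fun r _ => Ideal.mul_mem_left _ _ ?_
        obtain ⟨u, a, hu, hua⟩ := hfin r
        exact hP.mem_of_pow_mem a ((hP.mem_or_mem (hPle hua)).resolve_left fun h => hu (hPm h))
    have h1 := Ideal.height_le_card_of_mem_minimalPrimes_span (Set.toFinite _) hmin
    have h2 := (card_le_height_ker_constantCoeff K {t // t ∉ B}).trans h1
    have h3 : Set.ncard {slice ξ B f, slice ξ B g} ≤ 2 :=
      (Set.ncard_insert_le _ _).trans (by simp)
    exact (Nat.cast_le.mp h2).trans h3
  have hge : 2 ≤ Fintype.card {t // t ∉ B} := by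
    have h1 := (two_le_height_of_isRelPrime hfg hfq hgq).trans
      (height_le_card_of_algebraicIndepOn (fun p hp => (hξq p).mpr hp) hB)
    rw [Nat.card_eq_fintype_card] at h1
    exact_mod_cast h1
  obtain ⟨s, t, hst, huniv⟩ := Finset.card_eq_two.mp
    (show (Finset.univ : Finset {t // t ∉ B}).card = 2 by rw [Finset.card_univ]; omega)
  refine ⟨s.1, t.1, fun hcon => ?_⟩
  have h1 := hmem _ hcon
  rw [map_mul, map_sub, map_mul, map_mul, ← pderiv_slice, ← pderiv_slice, ← pderiv_slice,
    ← pderiv_slice] at h1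
  refine mul_jacobian_notMem_span_pair hst (fun r => ?_) ((hconst f).mpr hfq)
    ((hconst g).mpr hgq) hfin (fun h' => hh ((hconst h).mp h')) h1
  have := Finset.mem_univ r
  rw [huniv] at this
  simpa using this

/-! ### Flat base change of colon ideals -/

section Flat

variable {S R : Type*} [CommRing S] [CommRing R]

theorem exists_sum_of_mem_map {φ : S →+* R} {N : Ideal S} {r : R} (h : r ∈ N.map φ) :
    ∃ (n : ℕ) (a : Fin n → S) (w : Fin n → R), (∀ i, a i ∈ N) ∧ r = ∑ i, φ (a i) * w i := by
  obtain ⟨n, w, g, hg⟩ := Submodule.mem_span_set'.mp h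
  choose a ha hag using fun i => (g i).2
  refine ⟨n, a, w, ha, ?_⟩
  rw [← hg]
  exact Finset.sum_congr rfl fun i _ => by rw [hag, smul_eq_mul, mul_comm]

theorem exists_of_sum_mul_eq_zero_of_flat {φ : S →+* R} (hφ : φ.Flat) {ι : Type*} [Fintype ι]
    {f : ι → S} {x : ι → R} (h : ∑ i, φ (f i) * x i = 0) :
    ∃ (k : ℕ) (a : ι → Fin k → S) (y : Fin k → R), (∀ i, x i = ∑ j, φ (a i j) * y j) ∧
      ∀ j, ∑ i, f i * a i j = 0 := by
  algebraize [φ]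
  exact Module.Flat.isTrivialRelation_of_sum_smul_eq_zero (R := S) (M := R) h

/-- Flatness trivialises the relation `r φ(c) = ∑ φ(b_i) w_i`: it expresses `r` through elements of
`S` that are first entries of relations between `c` and the `b_i`, hence lie in `N : c`. -/
theorem mem_map_colon_of_flat {φ : S →+* R} (hφ : φ.Flat) {N : Ideal S} {c : S} {r : R}
    (h : r * φ c ∈ N.map φ) : r ∈ (N.colon {c}).map φ := by
  obtain ⟨n, b, w, hb, hr⟩ := exists_sum_of_mem_map h
  have hrel : ∑ i : Fin (n + 1), φ ((Fin.cons c fun i => -b i : Fin (n + 1) → S) i) *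
      (Fin.cons r w : Fin (n + 1) → R) i = 0 := by
    rw [Fin.sum_univ_succ]
    simp only [Fin.cons_zero, Fin.cons_succ, map_neg, neg_mul, Finset.sum_neg_distrib]
    rw [← hr]; ring
  obtain ⟨k, a, y, hx, ha⟩ := exists_of_sum_mul_eq_zero_of_flat hφ hrel
  have h1 := hx 0
  rw [Fin.cons_zero] at h1
  rw [h1]
  refine Ideal.sum_mem _ fun j _ => Ideal.mul_mem_right _ _ (Ideal.mem_map_of_mem φ ?_)
  rw [Submodule.mem_colon_singleton, smul_eq_mul]
  have h2 := ha j
  rw [Fin.sum_univ_succ] at h2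
  simp only [Fin.cons_zero, Fin.cons_succ, neg_mul, Finset.sum_neg_distrib] at h2
  have h3 : a 0 j * c = ∑ i : Fin n, b i * a i.succ j := by linear_combination h2
  rw [h3]
  exact Ideal.sum_mem _ fun i _ => Ideal.mul_mem_right _ _ (hb i)

theorem mem_map_inf_of_flat {φ : S →+* R} (hφ : φ.Flat) {N N' : Ideal S} {r : R}
    (h : r ∈ N.map φ) (h' : r ∈ N'.map φ) : r ∈ (N ⊓ N').map φ := by
  obtain ⟨n, b, w, hb, hr⟩ := exists_sum_of_mem_map h
  obtain ⟨n', b', w', hb', hr'⟩ := exists_sum_of_mem_map h'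
  have hrel : ∑ i : Fin n ⊕ Fin n', φ (Sum.elim b (fun i => -b' i) i) * Sum.elim w w' i = 0 := by
    rw [Fintype.sum_sum_type]
    simp only [Sum.elim_inl, Sum.elim_inr, map_neg, neg_mul, Finset.sum_neg_distrib]
    rw [← hr, ← hr']; ring
  obtain ⟨k, a, y, hx, ha⟩ := exists_of_sum_mul_eq_zero_of_flat hφ hrel
  have h1 : r = ∑ j, φ (∑ i, b i * a (Sum.inl i) j) * y j := by
    rw [hr]
    simp only [map_sum, Finset.sum_mul]
    rw [Finset.sum_comm]
    refine Finset.sum_congr rfl fun i _ => ?_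
    have h2 := hx (Sum.inl i)
    rw [Sum.elim_inl] at h2
    rw [h2, Finset.mul_sum]
    exact Finset.sum_congr rfl fun j _ => by rw [map_mul, mul_assoc]
  rw [h1]
  refine Ideal.sum_mem _ fun j _ => Ideal.mul_mem_right _ _ (Ideal.mem_map_of_mem φ ⟨?_, ?_⟩)
  · exact Ideal.sum_mem _ fun i _ => Ideal.mul_mem_right _ _ (hb i)
  · have h2 := ha j
    rw [Fintype.sum_sum_type] at h2
    simp only [Sum.elim_inl, Sum.elim_inr, neg_mul, Finset.sum_neg_distrib] at h2
    have h3 : ∑ i, b i * a (Sum.inl i) j = ∑ i, b' i * a (Sum.inr i) j := by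
      linear_combination h2
    rw [h3]
    exact Ideal.sum_mem _ fun i _ => Ideal.mul_mem_right _ _ (hb' i)

theorem mem_map_iInf_colon_of_flat {φ : S →+* R} (hφ : φ.Flat) {N : Ideal S} {ι : Type*}
    (s : Finset ι) {c : ι → S} {r : R} (h : ∀ i ∈ s, r * φ (c i) ∈ N.map φ) :
    r ∈ (⨅ i ∈ s, N.colon {c i}).map φ := by
  classical
  induction s using Finset.induction_on with
  | empty => simp [Ideal.map_top]
  | insert a s ha ih =>
    rw [Finset.iInf_insert]
    exact mem_map_inf_of_flat hφ (mem_map_colon_of_flat hφ (h a (by simp)))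
      (ih fun i hi => h i (by simp [hi]))

/-- Going down: a smaller prime over `I` would lift to a prime inside `q` that still contains `I.map
φ`. -/
theorem comap_mem_minimalPrimes_of_flat {φ : S →+* R} (hφ : φ.Flat) {I : Ideal S} {q : Ideal R}
    (hq : q ∈ (I.map φ).minimalPrimes) : q.comap φ ∈ I.minimalPrimes := by
  have hqp : q.IsPrime := hq.1.1
  refine ⟨⟨Ideal.comap_isPrime φ q, Ideal.map_le_iff_le_comap.mp hq.1.2⟩, ?_⟩
  rintro p ⟨hp, hIp⟩ hpq
  algebraize [φ]
  have : q.LiesOver (q.comap φ) := ⟨rfl⟩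
  have hgd : Algebra.HasGoingDown S R := inferInstance
  have : (q.comap φ).IsPrime := Ideal.comap_isPrime φ q
  obtain ⟨P, hPq, hP, hPp⟩ := Ideal.exists_ideal_le_liesOver_of_le q hpq
  have hPp' : p = P.comap φ := hPp.over
  have h1 : I.map φ ≤ P := Ideal.map_le_iff_le_comap.mpr (hPp' ▸ hIp)
  rw [hPp']
  exact Ideal.comap_mono (hq.2 ⟨hP, h1⟩ hPq)

theorem injective_of_flat [IsDomain S] [Nontrivial R] {φ : S →+* R} (hφ : φ.Flat) :
    Function.Injective φ := by
  rw [injective_iff_map_eq_zero]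
  intro x hx
  by_contra hx0
  obtain ⟨k, a, y, h1, h2⟩ := exists_of_sum_mul_eq_zero_of_flat hφ (ι := Unit)
    (f := fun _ => x) (x := fun _ => 1) (by simp [hx])
  have h3 : ∀ j, a () j = 0 := fun j => by
    have := h2 j
    simp only [Finset.univ_unique, Finset.sum_singleton, mul_eq_zero] at this
    exact this.resolve_left hx0
  have h4 := h1 ()
  simp only [h3, map_zero, zero_mul, Finset.sum_const_zero] at h4
  exact one_ne_zero h4

/-- If `φ x = d f` and `φ y = d g`, then `g φ(x)` is a multiple of `φ y`. Flatness and the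
regularity of `x` modulo `y` put `g` in `(φ y) = (d g)`, so `d` is a unit. -/
theorem isRelPrime_map_of_flat [IsDomain S] [IsDomain R] [UniqueFactorizationMonoid R]
    {φ : S →+* R} (hφ : φ.Flat) {x y : S} (hy : y ≠ 0) (hxy : ∀ a b, x * a = y * b → y ∣ a) :
    IsRelPrime (φ x) (φ y) := by
  obtain ⟨d, f, g, hfg, hf, hg⟩ := exists_eq_mul_isRelPrime (φ x) (φ y)
  have h1 : g * φ x ∈ (Ideal.span {y}).map φ := by
    rw [Ideal.map_span, Set.image_singleton, Ideal.mem_span_singleton]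
    exact ⟨f, by rw [hf, hg]; ring⟩
  have h2 := mem_map_colon_of_flat hφ h1
  have h3 : (Ideal.span {y}).colon {x} ≤ Ideal.span {y} := by
    intro a ha
    rw [Submodule.mem_colon_singleton, smul_eq_mul, Ideal.mem_span_singleton] at ha
    obtain ⟨b, hb⟩ := ha
    exact Ideal.mem_span_singleton.mpr (hxy a b (by rw [mul_comm, hb]))
  have h4 := Ideal.map_mono h3 h2
  rw [Ideal.map_span, Set.image_singleton, Ideal.mem_span_singleton, hg] at h4
  have hg0 : g ≠ 0 := by
    rintro rfl
    exact hy ((injective_iff_map_eq_zero φ).mp (injective_of_flat hφ) y (by rw [hg, mul_zero]))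
  have hd : IsUnit d := by
    obtain ⟨c, hc⟩ := h4
    have : g * (1 - d * c) = 0 := by linear_combination hc
    rcases mul_eq_zero.mp this with h | h
    · exact absurd h hg0
    · exact IsUnit.of_mul_eq_one c (by linear_combination -h)
  rw [hf, hg]
  exact (isRelPrime_mul_unit_left hd).mpr hfg

end Flat

/-! ### Unmixedness of the unfoldings ideal -/

section Unmixed

/-- Prime avoidance: take any nonzero `x ∈ J`, and `y ∈ J` outside the finitely many primes
generated by factors of `x`. -/
theorem exists_isRelPrime_mem {S : Type*} [CommRing S] [IsDomain S] [UniqueFactorizationMonoid S]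
    {J : Ideal S} (hJ : J ≠ ⊥) (h : ∀ π, Prime π → ¬ J ≤ Ideal.span {π}) :
    ∃ x ∈ J, ∃ y ∈ J, x ≠ 0 ∧ IsRelPrime x y := by
  classical
  obtain ⟨x, hx, hx0⟩ := Submodule.exists_mem_ne_zero_of_ne_bot hJ
  have hfac : ∀ π ∈ UniqueFactorizationMonoid.factors x, Prime π :=
    fun π hπ => UniqueFactorizationMonoid.prime_of_factor π hπ
  have hnot : ¬ (J : Set S) ⊆ ⋃ π ∈ ((UniqueFactorizationMonoid.factors x).toFinset : Set S),
      (Ideal.span {π} : Ideal S) := by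
    rw [Ideal.subset_union_prime 0 0]
    · rintro ⟨π, hπ, hle⟩
      exact h π (hfac π (Multiset.mem_toFinset.mp hπ)) hle
    · intro π hπ _ _
      have := hfac π (Multiset.mem_toFinset.mp hπ)
      exact (Ideal.span_singleton_prime this.ne_zero).mpr this
  obtain ⟨y, hy, hy'⟩ := Set.not_subset.mp hnot
  refine ⟨x, hx, y, hy, hx0, fun d hdx hdy => ?_⟩
  by_contra hd
  obtain ⟨π, hπ, hπd⟩ := WfDvdMonoid.exists_irreducible_factor hd (ne_zero_of_dvd_ne_zero hx0 hdx)
  obtain ⟨π', hπ', hass⟩ :=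
    UniqueFactorizationMonoid.exists_mem_factors_of_dvd hx0 hπ (hπd.trans hdx)
  refine hy' (Set.mem_biUnion (by simpa using hπ') ?_)
  exact Ideal.mem_span_singleton.mpr (hass.symm.dvd.trans (hπd.trans hdy))

theorem exists_eq_mul_of_mul_eq_mul {S : Type*} [CommRing S] [IsDomain S]
    [UniqueFactorizationMonoid S] {x y p q : S} (hx : x ≠ 0) (hxy : IsRelPrime x y)
    (h : x * p = y * q) : ∃ c, p = y * c ∧ q = x * c := by
  obtain ⟨c, rfl⟩ := hxy.dvd_of_dvd_mul_left ⟨p, h.symm⟩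
  exact ⟨c, mul_left_cancel₀ hx (by rw [h]; ring), rfl⟩

/-- The quotient by a complete intersection of codimension two has no nonzero elements annihilated
by a regular sequence of length three. -/
theorem mem_span_pair_of_regular {S : Type*} [CommRing S] [IsDomain S]
    [UniqueFactorizationMonoid S] {x y z₁ z₂ w r : S} (hx : x ≠ 0) (hxy : IsRelPrime x y)
    (hz : Prime z₁) (hz₂ : ¬ z₁ ∣ z₂)
    (hw : ∀ c, w * c ∈ Ideal.span {z₁, z₂} → c ∈ Ideal.span {z₁, z₂})
    (h₁ : z₁ * r ∈ Ideal.span {x, y}) (h₂ : z₂ * r ∈ Ideal.span {x, y})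
    (h₃ : w * r ∈ Ideal.span {x, y}) : r ∈ Ideal.span {x, y} := by
  obtain ⟨a₁, b₁, e₁⟩ := Ideal.mem_span_pair.mp h₁
  obtain ⟨a₂, b₂, e₂⟩ := Ideal.mem_span_pair.mp h₂
  obtain ⟨a₃, b₃, e₃⟩ := Ideal.mem_span_pair.mp h₃
  -- A Koszul argument. Comparing the three expressions pairwise gives `c₁₂, c₁₃, c₂₃` with `w c₁₂ ∈
  -- (z₁, z₂)`, so `c₁₂ = u z₁ + v z₂`. Replacing `a₁, b₁` by `a₁ - y v, b₁ + x v` leaves `a₁ x + b₁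
  -- y` unchanged and makes both coefficients divisible by `z₁`.
  obtain ⟨c₁₂, k₁₂, l₁₂⟩ := exists_eq_mul_of_mul_eq_mul (p := z₂ * a₁ - z₁ * a₂)
    (q := z₁ * b₂ - z₂ * b₁) hx hxy (by linear_combination z₂ * e₁ - z₁ * e₂)
  obtain ⟨c₁₃, k₁₃, l₁₃⟩ := exists_eq_mul_of_mul_eq_mul (p := w * a₁ - z₁ * a₃)
    (q := z₁ * b₃ - w * b₁) hx hxy (by linear_combination w * e₁ - z₁ * e₃)
  obtain ⟨c₂₃, k₂₃, l₂₃⟩ := exists_eq_mul_of_mul_eq_mul (p := w * a₂ - z₂ * a₃)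
    (q := z₂ * b₃ - w * b₂) hx hxy (by linear_combination w * e₂ - z₂ * e₃)
  have hc : w * c₁₂ = z₂ * c₁₃ - z₁ * c₂₃ :=
    mul_left_cancel₀ hx (by linear_combination -w * l₁₂ + z₂ * l₁₃ - z₁ * l₂₃)
  obtain ⟨u, v, huv⟩ := Ideal.mem_span_pair.mp (hw c₁₂ (by
    rw [hc]
    exact Ideal.mem_span_pair.mpr ⟨-c₂₃, c₁₃, by ring⟩))
  have hdvd : ∀ q, z₁ ∣ z₂ * q → z₁ ∣ q := fun q hq => (hz.dvd_or_dvd hq).resolve_left hz₂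
  obtain ⟨s, hs⟩ := hdvd (a₁ - y * v) ⟨a₂ + y * u, by linear_combination k₁₂ - y * huv⟩
  obtain ⟨t, ht⟩ := hdvd (b₁ + x * v) ⟨b₂ - x * u, by linear_combination -l₁₂ + x * huv⟩
  refine Ideal.mem_span_pair.mpr ⟨s, t, ?_⟩
  apply mul_left_cancel₀ hz.ne_zero
  linear_combination e₁ - x * hs - y * ht

variable {σ : Type*} [Fintype σ]

/-- De Rham division. Contracting `A ∧ ψ = 0` with `V` gives `x ψ = (V·ψ) A`; contracting that with
`W` gives `x (W·ψ) = y (V·ψ)`, so `x ∣ V·ψ`. -/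
theorem exists_eq_mul_of_wedge_eq_zero {A ψ V W : OneForm σ} {x y : MvPolynomial σ ℂ}
    (hV : ∑ i, V i * A i = x) (hW : ∑ i, W i * A i = y) (hx : x ≠ 0) (hxy : IsRelPrime x y)
    (h : ∀ j k, A j * ψ k = A k * ψ j) : ∃ c, ∀ k, ψ k = c * A k := by
  have h1 : ∀ k, x * ψ k = A k * ∑ i, V i * ψ i := fun k => by
    rw [← hV, Finset.sum_mul, Finset.mul_sum]
    exact Finset.sum_congr rfl fun i _ => by linear_combination V i * h i k
  have h2 : x * ∑ k, W k * ψ k = y * ∑ i, V i * ψ i := by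
    rw [← hW, Finset.sum_mul, Finset.mul_sum]
    exact Finset.sum_congr rfl fun k _ => by linear_combination W k * h1 k
  obtain ⟨c, -, hc⟩ := exists_eq_mul_of_mul_eq_mul hx hxy h2
  refine ⟨c, fun k => mul_left_cancel₀ hx ?_⟩
  rw [h1, hc]; ring

/-- This is `α ∧ dα = 0` contracted with the vector field `V`. -/
theorem mul_extD_of_isIntegrable {A V : OneForm σ} (hA : IsIntegrable A) (j k : σ) :
    (∑ i, V i * A i) * extD A j k =
      A j * (∑ i, V i * extD A i k) - A k * (∑ i, V i * extD A i j) := by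
  rw [Finset.sum_mul, Finset.mul_sum, Finset.mul_sum, ← Finset.sum_sub_distrib]
  exact Finset.sum_congr rfl fun i _ => by linear_combination V i * hA i j k

/-- If the singular locus has codimension at least two, then the unfoldings ideal is a colon ideal
of a complete intersection of codimension two. -/
theorem exists_mem_unfoldingsIdeal_iff {A : OneForm σ} (hA : IsIntegrable A)
    {x y : MvPolynomial σ ℂ} (hxJ : x ∈ singularIdeal A) (hyJ : y ∈ singularIdeal A) (hx : x ≠ 0)
    (hxy : IsRelPrime x y) :
    ∃ e, ∀ h, h ∈ unfoldingsIdeal A ↔ h * e ∈ Ideal.span {x, y} := by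
  obtain ⟨V, hV⟩ := Ideal.mem_span_range_iff_exists_fun.mp hxJ
  obtain ⟨W, hW⟩ := Ideal.mem_span_range_iff_exists_fun.mp hyJ
  set θ : OneForm σ := fun k => ∑ i, V i * extD A i k with hθ
  set χ : OneForm σ := fun k => ∑ i, W i * extD A i k with hχ
  have hxB : ∀ j k, x * extD A j k = A j * θ k - A k * θ j := fun j k => by
    rw [← hV]; exact mul_extD_of_isIntegrable hA j k
  have hyB : ∀ j k, y * extD A j k = A j * χ k - A k * χ j := fun j k => by
    rw [← hW]; exact mul_extD_of_isIntegrable hA j k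
  -- Since `x dα = α ∧ θ` and `y dα = α ∧ χ`, the form `y θ - x χ` is killed by `α ∧ ·` and equals
  -- `e α`. The function `e` measures how far the local solutions `θ/x` and `χ/y` are from agreeing.
  obtain ⟨e, he⟩ := exists_eq_mul_of_wedge_eq_zero (ψ := fun k => y * θ k - x * χ k) hV hW hx hxy
    (fun j k => by linear_combination x * hyB j k - y * hxB j k)
  refine ⟨e, fun h => ⟨?_, ?_⟩⟩
  · rintro ⟨η, hη⟩
    have hη' : ∀ j k, h * extD A j k = A j * η k - A k * η j := fun j k =>
      congrFun (congrFun hη j) k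
    obtain ⟨c, hc⟩ := exists_eq_mul_of_wedge_eq_zero (ψ := fun k => x * η k - h * θ k) hV hW hx hxy
      (fun j k => by linear_combination h * hxB j k - x * hη' j k)
    have h1 : ∀ k, (h * e + c * y) * A k = x * (y * η k - h * χ k) := fun k => by
      linear_combination -h * he k - y * hc k
    have h2 : x ∣ y * (h * e + c * y) := by
      rw [← hW, Finset.sum_mul]
      refine Finset.dvd_sum fun k _ => ⟨W k * (y * η k - h * χ k), ?_⟩
      rw [← hW] at h1 ⊢
      linear_combination W k * h1 k
    obtain ⟨d, hd⟩ := hxy.dvd_of_dvd_mul_left h2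
    exact Ideal.mem_span_pair.mpr ⟨d, -c, by linear_combination -hd⟩
  · intro hhe
    obtain ⟨d, c, hdc⟩ := Ideal.mem_span_pair.mp hhe
    -- With `h e = d x + c y` one has `y (h θ - c α) = x (h χ + d α)`; the form `η = (h θ - c α)/x`
    -- is then polynomial and solves `h dα = α ∧ η`.
    have h1 : ∀ k, x ∣ h * θ k - c * A k := fun k => by
      refine hxy.dvd_of_dvd_mul_left ⟨h * χ k + d * A k, ?_⟩
      linear_combination h * he k - A k * hdc
    choose η hη using h1
    refine ⟨η, ?_⟩
    ext1 j; ext1 k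
    apply mul_left_cancel₀ hx
    simp only [Pi.smul_apply, smul_eq_mul, wedge]
    linear_combination h * hxB j k + A j * hη k - A k * hη j

/-- The minimal primes of the unfoldings ideal have height at most two: they do not contain regular
sequences of length three. -/
theorem notMem_of_mem_minimalPrimes_unfoldingsIdeal {A : OneForm σ} (hA : IsIntegrable A)
    (hJ : singularIdeal A ≠ ⊥) (hJπ : ∀ π, Prime π → ¬ singularIdeal A ≤ Ideal.span {π})
    {p : Ideal (MvPolynomial σ ℂ)} (hp : p ∈ (unfoldingsIdeal A).minimalPrimes)
    {z₁ z₂ w : MvPolynomial σ ℂ} (h₁ : z₁ ∈ p) (h₂ : z₂ ∈ p) (hz : Prime z₁) (hz₂ : ¬ z₁ ∣ z₂)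
    (hw : ∀ c, w * c ∈ Ideal.span {z₁, z₂} → c ∈ Ideal.span {z₁, z₂}) : w ∉ p := by
  intro h₃
  obtain ⟨x, hxJ, y, hyJ, hx, hxy⟩ := exists_isRelPrime_mem hJ hJπ
  obtain ⟨e, he⟩ := exists_mem_unfoldingsIdeal_iff hA hxJ hyJ hx hxy
  -- A minimal prime is associated, so `p = (I(α) : s) = ((x, y) : s e)`. A regular sequence of
  -- length three in `p` would force `s e ∈ (x, y)`, that is `1 ∈ p`.
  obtain ⟨s, hs⟩ := Submodule.exists_eq_colon_of_mem_minimalPrimes (N := unfoldingsIdeal A) (x := 1)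
    (I := p) (by
      convert hp using 2
      ext a
      simp [Submodule.mem_colon_singleton])
  have hps : ∀ a, a ∈ p ↔ a * (s * e) ∈ Ideal.span {x, y} := fun a => by
    rw [hs, Submodule.mem_colon_singleton, smul_eq_mul, he, mul_assoc]
  have h4 := mem_span_pair_of_regular hx hxy hz hz₂ hw ((hps _).mp h₁) ((hps _).mp h₂)
    ((hps _).mp h₃)
  exact hp.1.1.ne_top ((Ideal.eq_top_iff_one _).mpr ((hps 1).mpr (by rwa [one_mul])))

end Unmixed

/-! ### Pullbacks of forms -/

section Pullback

variable {σ τ : Type*} [Fintype σ]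

theorem pderiv_aeval (F : σ → MvPolynomial τ ℂ) (μ : τ) (p : MvPolynomial σ ℂ) :
    pderiv μ (aeval F p) = ∑ k, aeval F (pderiv k p) * pderiv μ (F k) := by
  classical
  induction p using MvPolynomial.induction_on with
  | C a => simp [algebraMap_eq]
  | add p q hp hq => simp only [map_add, hp, hq, add_mul, Finset.sum_add_distrib]
  | mul_X p t hp =>
    rw [map_mul, Derivation.leibniz, hp, aeval_X]
    simp only [Derivation.leibniz, smul_eq_mul, map_add, map_mul, aeval_X, add_mul,
      Finset.sum_add_distrib, pderiv_X]
    congr 1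
    · rw [Finset.sum_eq_single t]
      · simp
      · intro k _ hk; simp [hk.symm]
      · simp
    · rw [Finset.mul_sum]
      exact Finset.sum_congr rfl fun k _ => by ring

theorem pderiv_pderiv_comm (i j : τ) (p : MvPolynomial τ ℂ) :
    pderiv i (pderiv j p) = pderiv j (pderiv i p) := by
  classical
  have h : ⁅(pderiv i : Derivation ℂ (MvPolynomial τ ℂ) (MvPolynomial τ ℂ)), pderiv j⁆ =
      (0 : Derivation ℂ (MvPolynomial τ ℂ) (MvPolynomial τ ℂ)) := by
    apply MvPolynomial.derivation_ext
    intro k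
    rw [Derivation.commutator_apply, pderiv_X, pderiv_X]
    by_cases h1 : j = k <;> by_cases h2 : i = k <;> simp [h1, h2]
  have h1 := congrArg (fun d => d p) h
  simpa [Derivation.commutator_apply, sub_eq_zero] using h1

theorem wedge_pullback (F : σ → MvPolynomial τ ℂ) (A η : OneForm σ) (μ ν : τ) :
    wedge (pullback F A) (pullback F η) μ ν =
      ∑ k, ∑ l, aeval F (wedge A η k l) * (pderiv μ (F k) * pderiv ν (F l)) := by
  simp only [wedge, pullback, map_sub, map_mul]
  rw [Finset.sum_mul_sum, Finset.sum_mul_sum]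
  conv_lhs => arg 2; rw [Finset.sum_comm]
  rw [← Finset.sum_sub_distrib]
  refine Finset.sum_congr rfl fun k _ => ?_
  rw [← Finset.sum_sub_distrib]
  exact Finset.sum_congr rfl fun l _ => by ring

theorem extD_pullback (F : σ → MvPolynomial τ ℂ) (A : OneForm σ) (μ ν : τ) :
    extD (pullback F A) μ ν =
      ∑ k, ∑ l, aeval F (extD A k l) * (pderiv μ (F k) * pderiv ν (F l)) := by
  have h : ∀ μ ν, pderiv μ (∑ l, aeval F (A l) * pderiv ν (F l)) =
      ∑ k, ∑ l, aeval F (pderiv k (A l)) * (pderiv μ (F k) * pderiv ν (F l)) +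
        ∑ l, aeval F (A l) * pderiv μ (pderiv ν (F l)) := by
    intro μ ν
    have h1 : ∀ l, pderiv μ (aeval F (A l) * pderiv ν (F l)) =
        ∑ k, aeval F (pderiv k (A l)) * (pderiv μ (F k) * pderiv ν (F l)) +
          aeval F (A l) * pderiv μ (pderiv ν (F l)) := by
      intro l
      simp only [pderiv_mul, pderiv_aeval, Finset.sum_mul, mul_assoc]
    rw [map_sum, Finset.sum_congr rfl fun l _ => h1 l, Finset.sum_add_distrib, Finset.sum_comm]
  have h2 : ∑ k, ∑ l, aeval F (pderiv k (A l)) * (pderiv ν (F k) * pderiv μ (F l)) =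
      ∑ k, ∑ l, aeval F (pderiv l (A k)) * (pderiv μ (F k) * pderiv ν (F l)) := by
    rw [Finset.sum_comm]
    exact Finset.sum_congr rfl fun k _ => Finset.sum_congr rfl fun l _ => by ring
  have h3 : ∑ l, aeval F (A l) * pderiv ν (pderiv μ (F l)) =
      ∑ l, aeval F (A l) * pderiv μ (pderiv ν (F l)) :=
    Finset.sum_congr rfl fun l _ => by rw [pderiv_pderiv_comm]
  change pderiv μ (∑ l, aeval F (A l) * pderiv ν (F l)) -
    pderiv ν (∑ l, aeval F (A l) * pderiv μ (F l)) = _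
  rw [h, h, h2, h3, add_sub_add_right_eq_sub, ← Finset.sum_sub_distrib]
  refine Finset.sum_congr rfl fun k _ => ?_
  rw [← Finset.sum_sub_distrib]
  refine Finset.sum_congr rfl fun l _ => ?_
  rw [extD, map_sub, sub_mul]

theorem mem_kupkaIdeal_iff {σ : Type*} {A : OneForm σ} {h : MvPolynomial σ ℂ} :
    h ∈ kupkaIdeal A ↔ ∀ i j, h * extD A i j ∈ singularIdeal A := by
  constructor
  · intro hh i j
    exact Submodule.mem_colon.mp hh _ (Ideal.subset_span ⟨i, j, rfl⟩)
  · intro hh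
    refine Submodule.mem_colon.mpr fun p hp => ?_
    rw [smul_eq_mul]
    refine Submodule.span_induction (p := fun x _ => h * x ∈ singularIdeal A) ?_ ?_ ?_ ?_ hp
    · rintro _ ⟨i, j, rfl⟩; exact hh i j
    · simp
    · intro x y _ _ hx hy; rw [mul_add]; exact Ideal.add_mem _ hx hy
    · intro a x _ hx
      rw [smul_eq_mul, mul_left_comm]
      exact Ideal.mul_mem_left _ _ hx

theorem mem_singularIdeal {σ : Type*} (A : OneForm σ) (i : σ) : A i ∈ singularIdeal A :=
  Ideal.subset_span ⟨i, rfl⟩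

theorem unfoldingsIdeal_le_kupkaIdeal {σ : Type*} (A : OneForm σ) :
    unfoldingsIdeal A ≤ kupkaIdeal A := by
  rintro h ⟨η, hη⟩
  refine mem_kupkaIdeal_iff.mpr fun i j => ?_
  have h1 : h * extD A i j = wedge A η i j := congrFun (congrFun hη i) j
  rw [h1, wedge]
  exact Ideal.sub_mem _ (Ideal.mul_mem_right _ _ (mem_singularIdeal A i))
    (Ideal.mul_mem_right _ _ (mem_singularIdeal A j))

theorem singularIdeal_le_unfoldingsIdeal {A : OneForm σ} (hA : IsIntegrable A) :
    singularIdeal A ≤ unfoldingsIdeal A := by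
  intro h hh
  obtain ⟨V, rfl⟩ := Ideal.mem_span_range_iff_exists_fun.mp hh
  refine ⟨fun k => ∑ i, V i * extD A i k, ?_⟩
  ext1 j; ext1 k
  exact mul_extD_of_isIntegrable hA j k

theorem map_unfoldingsIdeal_le (F : σ → MvPolynomial τ ℂ) (A : OneForm σ) :
    (unfoldingsIdeal A).map (aeval F) ≤ unfoldingsIdeal (pullback F A) := by
  rw [Ideal.map_le_iff_le_comap]
  rintro h ⟨η, hη⟩
  refine ⟨pullback F η, ?_⟩
  ext1 μ; ext1 ν
  have h1 : ∀ k l, h * extD A k l = wedge A η k l := fun k l => congrFun (congrFun hη k) l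
  change aeval F h * extD (pullback F A) μ ν = _
  rw [extD_pullback, wedge_pullback, Finset.mul_sum]
  refine Finset.sum_congr rfl fun k _ => ?_
  rw [Finset.mul_sum]
  refine Finset.sum_congr rfl fun l _ => ?_
  rw [← h1, map_mul, mul_assoc]

theorem singularIdeal_pullback_le (F : σ → MvPolynomial τ ℂ) (A : OneForm σ) :
    singularIdeal (pullback F A) ≤ (singularIdeal A).map (aeval F) := by
  rw [singularIdeal, Ideal.span_le]
  rintro _ ⟨μ, rfl⟩
  exact Ideal.sum_mem _ fun i _ => Ideal.mul_mem_right _ _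
    (Ideal.mem_map_of_mem _ (mem_singularIdeal A i))

end Pullback

/-! ### Homogeneity -/

section Homogeneous

variable {σ : Type*} [Fintype σ]

theorem isWeightedHomogeneous_map_weight {σ R M N : Type*} [CommSemiring R] [AddCommMonoid M]
    [AddCommMonoid N] {w : σ → M} {p : MvPolynomial σ R} {n : M}
    (hp : IsWeightedHomogeneous w p n) (f : M →+ N) :
    IsWeightedHomogeneous (fun i => f (w i)) p (f n) := by
  intro d hd
  rw [← hp hd, Finsupp.weight_apply, Finsupp.weight_apply, Finsupp.sum, Finsupp.sum, map_sum]
  exact Finset.sum_congr rfl fun i _ => (map_nsmul f _ _).symm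

theorem sum_weight_mul_X_mul_pderiv {w : σ → ℤ} {p : MvPolynomial σ ℂ} {n : ℤ}
    (hp : IsWeightedHomogeneous w p n) :
    ∑ k, C (w k : ℂ) * X k * pderiv k p = C (n : ℂ) * p := by
  have h1 : ∀ d ∈ p.support, ∑ k, C (w k : ℂ) * X k * pderiv k (monomial d (coeff d p)) =
      C (n : ℂ) * monomial d (coeff d p) := by
    intro d hd
    have h2 : ∑ k, (w k : ℂ) * (d k : ℂ) = (n : ℂ) := by
      rw [← hp (mem_support_iff.mp hd), Finsupp.weight_apply,
        Finsupp.sum_fintype _ _ (by simp)]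
      push_cast
      exact Finset.sum_congr rfl fun k _ => by simp [mul_comm]
    rw [← h2, map_sum, Finset.sum_mul]
    refine Finset.sum_congr rfl fun k _ => ?_
    rw [mul_assoc, X_mul_pderiv_monomial, map_mul, mul_assoc]
    congr 1
    rw [nsmul_eq_mul]
    simp
  conv_lhs => rw [p.as_sum]
  conv_rhs => rw [p.as_sum]
  simp only [map_sum, Finset.mul_sum]
  rw [Finset.sum_comm]
  exact Finset.sum_congr rfl fun d hd => h1 d hd

namespace ToricSurface

variable {m : ℕ} (X : ToricSurface m)

/-- The degree on `Cl(X)` defined by a relation among the rays. -/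
def relationDegree {a : Fin m → ℤ} (ha : X.IsRelation a) : X.Cl →+ ℤ :=
  QuotientAddGroup.lift X.divOfChar.range
    { toFun := fun b => ∑ i, a i * b i
      map_zero' := by simp
      map_add' := fun b c => by simp [mul_add, Finset.sum_add_distrib] } (by
    rintro _ ⟨u, rfl⟩
    have h1 : ∀ k, ∑ i, a i * X.ray i k = 0 := fun k => by
      have := congrFun ha k
      simpa using this
    change ∑ i, a i * (∑ k, u k * X.ray i k) = 0
    simp only [Finset.mul_sum]
    rw [Finset.sum_comm]
    refine Finset.sum_eq_zero fun k _ => ?_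
    rw [← mul_zero (u k), ← h1 k, Finset.mul_sum]
    exact Finset.sum_congr rfl fun i _ => by ring)

theorem relationDegree_degVar {a : Fin m → ℤ} (ha : X.IsRelation a) (i : Fin m) :
    X.relationDegree ha (X.degVar i) = a i := by
  change ∑ j, a j * (Pi.single i 1 : Fin m → ℤ) j = a i
  simp [Pi.single_apply]

variable {X} {D : X.Cl} {A : OneForm (Fin m)}

theorem IsTwistedForm.isWeightedHomogeneous (hA : X.IsTwistedForm D A) {a : Fin m → ℤ}
    (ha : X.IsRelation a) (l : Fin m) :
    IsWeightedHomogeneous a (A l) (X.relationDegree ha D - a l) := by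
  have h1 := isWeightedHomogeneous_map_weight (hA.homogeneous l) (X.relationDegree ha)
  simpa only [relationDegree_degVar, map_sub] using h1

/-- The contraction of `dα` with a radial vector field is a multiple of `α`. -/
theorem IsTwistedForm.sum_mul_extD (hA : X.IsTwistedForm D A) {a : Fin m → ℤ}
    (ha : X.IsRelation a) (l : Fin m) :
    ∑ k, C (a k : ℂ) * MvPolynomial.X k * extD A k l =
      C ((X.relationDegree ha D : ℤ) : ℂ) * A l := by
  -- Cartan's formula in coordinates: Euler's identity computes the Lie derivative, and the
  -- derivative of the descent relation removes the remaining term.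
  have h1 := sum_weight_mul_X_mul_pderiv (hA.isWeightedHomogeneous ha l)
  have h2 := congrArg (pderiv l) (hA.descent a ha)
  have h3 : ∀ k, pderiv l (C (a k : ℂ) * MvPolynomial.X k * A k) =
      C (a k : ℂ) * MvPolynomial.X k * pderiv l (A k) +
        if k = l then C (a k : ℂ) * A k else 0 := by
    intro k
    rw [Derivation.leibniz, Derivation.leibniz, pderiv_C, pderiv_X, smul_eq_mul, smul_eq_mul]
    by_cases h : k = l
    · subst h; simp; ring
    · simp [h]
  rw [map_sum, map_zero] at h2
  simp only [h3, Finset.sum_add_distrib, Finset.sum_ite_eq', Finset.mem_univ, if_true] at h2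
  simp only [extD, mul_sub, Finset.sum_sub_distrib]
  rw [h1]
  push_cast
  rw [map_sub]
  linear_combination -h2

end ToricSurface

end Homogeneous

/-! ### Saturations -/

section Saturation

variable {R : Type*} [CommRing R]

theorem mem_saturation_iff {J I : Ideal R} {h : R} :
    h ∈ saturation J I ↔ ∃ d : ℕ, ∀ y ∈ I ^ d, h * y ∈ J := by
  constructor
  · rintro ⟨d, -, hd⟩
    exact ⟨d, fun y hy => Submodule.mem_colon.mp hd y hy⟩
  · rintro ⟨d, hd⟩
    exact ⟨d + 1, by omega, Submodule.mem_colon.mpr fun y hy =>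
      hd y (Ideal.pow_le_pow_right (Nat.le_succ d) hy)⟩

theorem saturation_mono {J J' I : Ideal R} (h : J ≤ J') : saturation J I ≤ saturation J' I := by
  intro x hx
  obtain ⟨d, hd⟩ := mem_saturation_iff.mp hx
  exact mem_saturation_iff.mpr ⟨d, fun y hy => h (hd y hy)⟩

theorem le_saturation (J I : Ideal R) : J ≤ saturation J I := fun _ hx =>
  mem_saturation_iff.mpr ⟨0, fun y _ => Ideal.mul_mem_right y J hx⟩

theorem exists_mul_pow_le_of_le_saturation [IsNoetherianRing R] {J I M : Ideal R}
    (h : M ≤ saturation J I) : ∃ d : ℕ, M * I ^ d ≤ J := by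
  obtain ⟨s, rfl⟩ := IsNoetherian.noetherian M
  have h1 : ∀ x ∈ s, ∃ d : ℕ, ∀ y ∈ I ^ d, x * y ∈ J := fun _ hx =>
    mem_saturation_iff.mp (h (Ideal.subset_span hx))
  choose! d hd using h1
  refine ⟨∑ x ∈ s, d x, ?_⟩
  rw [Ideal.mul_le]
  intro x hx y hy
  refine Submodule.span_induction (p := fun x _ => x * y ∈ J) ?_ ?_ ?_ ?_ hx
  · intro x hx
    exact hd x hx y (Ideal.pow_le_pow_right
      (Finset.single_le_sum (f := d) (fun _ _ => Nat.zero_le _) hx) hy)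
  · simp
  · intro a b _ _ ha hb; rw [add_mul]; exact Ideal.add_mem _ ha hb
  · intro a b _ hb; rw [smul_eq_mul, mul_assoc]; exact Ideal.mul_mem_left _ _ hb

theorem saturation_le_of_le [IsNoetherianRing R] {J J' I : Ideal R} (h : J' ≤ saturation J I) :
    saturation J' I ≤ saturation J I := by
  intro x hx
  obtain ⟨d, hd⟩ := mem_saturation_iff.mp hx
  obtain ⟨e, he⟩ := exists_mul_pow_le_of_le_saturation h
  refine mem_saturation_iff.mpr ⟨d + e, fun y hy => ?_⟩
  rw [pow_add] at hy
  refine Submodule.mul_induction_on hy (fun a ha b hb => ?_) (fun a b ha hb => ?_)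
  · rw [← mul_assoc]
    exact he (Ideal.mul_mem_mul (hd a ha) hb)
  · rw [mul_add]; exact Ideal.add_mem _ ha hb

theorem map_le_saturation_map {S : Type*} [CommRing S] (φ : S →+* R) {J J' I : Ideal S}
    (h : J' ≤ saturation J I) : J'.map φ ≤ saturation (J.map φ) (I.map φ) := by
  rw [Ideal.map_le_iff_le_comap]
  intro x hx
  obtain ⟨d, hd⟩ := mem_saturation_iff.mp (h hx)
  refine mem_saturation_iff.mpr ⟨d, fun y hy => ?_⟩
  rw [← Ideal.map_pow] at hy
  refine Submodule.span_induction (p := fun y _ => φ x * y ∈ J.map φ) ?_ ?_ ?_ ?_ hy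
  · rintro _ ⟨y, hy, rfl⟩
    rw [← map_mul]
    exact Ideal.mem_map_of_mem φ (hd y hy)
  · simp
  · intro a b _ _ ha hb; rw [mul_add]; exact Ideal.add_mem _ ha hb
  · intro a b _ hb; rw [smul_eq_mul, mul_left_comm]; exact Ideal.mul_mem_left _ _ hb

end Saturation

/-! ### The irrelevant ideal, and the Kupka ideal of `ω` away from `F⁻¹(Z)` -/

namespace ToricSurface

variable {m : ℕ} (X : ToricSurface m)

theorem empty_mem_cones : ∅ ∈ X.cones := by
  obtain ⟨s, hs, -⟩ := X.complete 0
  exact X.face_mem s hs ∅ (Finset.empty_subset s)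

/-- If all rays were independent, a cone containing `-∑ v_i` would yield a relation with
coefficients `1` or `1 + c_i ≥ 1`. -/
theorem univ_notMem_cones : Finset.univ ∉ X.cones := by
  intro huniv
  have hind := X.simplicial _ huniv
  have hind' : ∀ c : Fin m → ℝ, ∑ i, c i • (fun k => (X.ray i k : ℝ)) = 0 → ∀ i, c i = 0 := by
    intro c hc i
    have h1 := Fintype.linearIndependent_iff.mp hind (fun i => c i.1) (by
      rw [← hc]
      exact Finset.sum_coe_sort Finset.univ (fun i => c i • (fun k => (X.ray i k : ℝ))))
    exact h1 ⟨i, Finset.mem_univ i⟩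
  obtain ⟨s, -, c, hc, hp⟩ := X.complete (-∑ i, fun k => (X.ray i k : ℝ))
  have h1 := hind' (fun i => 1 + if i ∈ s then c i else 0) (by
    simp only [add_smul, one_smul, Finset.sum_add_distrib, ite_smul, zero_smul]
    rw [Finset.sum_ite_mem, Finset.univ_inter, ← hp, add_neg_cancel])
  rcases Nat.eq_zero_or_pos m with rfl | hm
  · obtain ⟨s, -, c, hc, hp⟩ := X.complete 1
    have h2 := congrFun hp 0
    simp [Finset.eq_empty_of_isEmpty s] at h2
  · have h2 := h1 ⟨0, hm⟩
    by_cases h3 : (⟨0, hm⟩ : Fin m) ∈ s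
    · have h4 := hc ⟨0, hm⟩
      simp only [h3, if_true] at h2
      linarith
    · simp [h3] at h2

theorem notMem_cones_of_irrelevantIdeal_le {p : Ideal (MvPolynomial (Fin m) ℂ)} [hp : p.IsPrime]
    (h : X.irrelevantIdeal ≤ p) {T : Finset (Fin m)} (hT : ∀ k, MvPolynomial.X k ∈ p → k ∈ T) :
    T ∉ X.cones := by
  intro hTc
  have h1 : ∏ i ∈ Tᶜ, MvPolynomial.X i ∈ p := h (Ideal.subset_span ⟨T, hTc, rfl⟩)
  obtain ⟨k, hk, hkp⟩ := (hp.prod_mem_iff).mp h1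
  exact Finset.mem_compl.mp hk (hT k hkp)

/-- That is, `Z` contains no divisor. Up to units a prime divides at most one variable, and both `∅`
and the singletons are cones. -/
theorem not_irrelevantIdeal_le_span_prime {π : MvPolynomial (Fin m) ℂ} (hπ : Prime π) :
    ¬ X.irrelevantIdeal ≤ Ideal.span {π} := by
  classical
  intro hle
  have hp : (Ideal.span {π}).IsPrime := (Ideal.span_singleton_prime hπ.ne_zero).mpr hπ
  by_cases h : ∃ k, π ∣ MvPolynomial.X k
  · obtain ⟨k, hk⟩ := h
    refine X.notMem_cones_of_irrelevantIdeal_le hle (T := {k}) (fun l hl => ?_) (X.ray_mem k)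
    have h1 : MvPolynomial.X k ∣ (MvPolynomial.X l : MvPolynomial (Fin m) ℂ) :=
      (hπ.irreducible.associated_of_dvd X_prime.irreducible hk).symm.dvd.trans
        (Ideal.mem_span_singleton.mp hl)
    rw [X_dvd_X] at h1
    simp_all
  · push Not at h
    exact X.notMem_cones_of_irrelevantIdeal_le hle (T := ∅)
      (fun l hl => absurd (Ideal.mem_span_singleton.mp hl) (h l)) X.empty_mem_cones

variable {X}

/-- Saturation by `I_Z` cannot remove a divisor, so a divisorial component of `J` would survive in
the saturation. -/
theorem not_le_span_prime_of_two_le_height {J : Ideal (MvPolynomial (Fin m) ℂ)}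
    (hJ : 2 ≤ (saturation J X.irrelevantIdeal).height) {π : MvPolynomial (Fin m) ℂ}
    (hπ : Prime π) : ¬ J ≤ Ideal.span {π} := by
  intro hle
  have hp : (Ideal.span {π}).IsPrime := (Ideal.span_singleton_prime hπ.ne_zero).mpr hπ
  have h1 : saturation J X.irrelevantIdeal ≤ Ideal.span {π} := by
    intro h hh
    obtain ⟨d, hd⟩ := mem_saturation_iff.mp hh
    have hnot : ¬ X.irrelevantIdeal ^ d ≤ Ideal.span {π} := fun h' =>
      X.not_irrelevantIdeal_le_span_prime hπ (hp.le_of_pow_le h')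
    obtain ⟨y, hy, hy'⟩ := SetLike.not_le_iff_exists.mp hnot
    exact (hp.mem_or_mem (hle (hd y hy))).resolve_right hy'
  have h2 := (hJ.trans (Ideal.height_mono h1)).trans
    (Ideal.height_span_singleton_le_one hπ.not_isUnit)
  exact absurd h2 (by norm_num)

theorem ne_bot_of_two_le_height {J : Ideal (MvPolynomial (Fin m) ℂ)}
    (hJ : 2 ≤ (saturation J X.irrelevantIdeal).height) : J ≠ ⊥ := by
  rintro rfl
  rcases Nat.eq_zero_or_pos m with rfl | hm
  · apply X.univ_notMem_cones
    rw [Finset.univ_eq_empty]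
    exact X.empty_mem_cones
  · exact not_le_span_prime_of_two_le_height hJ
      (X_prime (i := (⟨0, hm⟩ : Fin m))) bot_le

variable {n : ℕ} {D : X.Cl} {A : OneForm (Fin m)} {e : Fin m → ℕ}
  {F : Fin m → MvPolynomial (Fin (n + 1)) ℂ}

/-- Otherwise `F i` would have degree zero, so be constant, against injectivity of `F^*`. -/
theorem IsLifting.constantCoeff_eq_zero (hF : X.IsLifting e F)
    (hinj : Function.Injective (aeval F : MvPolynomial (Fin m) ℂ →ₐ[ℂ] _)) (i : Fin m) :
    constantCoeff (F i) = 0 := by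
  by_contra h
  have h1 : 0 = e i := by
    have := hF.homogeneous i (d := 0) (by simpa [constantCoeff_eq] using h)
    simpa using this
  have h2 : F i = C (coeff 0 (F i)) := by
    rw [← totalDegree_eq_zero_iff_eq_C (p := F i)]
    exact Nat.le_zero.mp (h1 ▸ (hF.homogeneous i).totalDegree_le)
  have h3 : aeval F (MvPolynomial.X i : MvPolynomial (Fin m) ℂ) =
      aeval F (C (coeff 0 (F i)) : MvPolynomial (Fin m) ℂ) := by
    rw [aeval_X, aeval_C, algebraMap_eq, ← h2]
  have h4 := congrArg totalDegree (hinj h3)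
  simp at h4

/-- Near a noncritical point, an element of the Kupka ideal of the pullback belongs to the extension
of the Kupka ideal. -/
theorem exists_mul_mem_map_kupkaIdeal_of_span_eq_top (hA : X.IsTwistedForm D A)
    (hflat : (aeval F : MvPolynomial (Fin m) ℂ →ₐ[ℂ] MvPolynomial (Fin (n + 1)) ℂ).toRingHom.Flat)
    {h : MvPolynomial (Fin (n + 1)) ℂ} (hh : h ∈ kupkaIdeal (pullback F A))
    {x : Fin (n + 1) → ℂ}
    (hx : Submodule.span ℂ
      (Set.range (fun k : Fin (n + 1) => fun i : Fin m => eval x (pderiv k (F i))) ∪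
        {w | ∃ a : Fin m → ℤ, X.IsRelation a ∧ w = fun i => (a i : ℂ) * eval x (F i)}) = ⊤) :
    ∃ u, eval x u ≠ 0 ∧ u * h ∈ (kupkaIdeal A).map (aeval F) := by
  classical
  -- Polynomial lifts of the spanning vectors. On two derivatives of `F` the form `b` gives a
  -- coefficient of `dω`, which `h` sends into `J̃(ω)`; with a radial field it already lands there.
  let G : Set (Fin m → MvPolynomial (Fin (n + 1)) ℂ) :=
    Set.range (fun k : Fin (n + 1) => fun i : Fin m => pderiv k (F i)) ∪
      {w | ∃ a : Fin m → ℤ, X.IsRelation a ∧ w = fun i => C (a i : ℂ) * F i}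
  let M := Submodule.span (MvPolynomial (Fin (n + 1)) ℂ) G
  let J := (singularIdeal A).map (aeval F)
  let b : (Fin m → MvPolynomial (Fin (n + 1)) ℂ) → (Fin m → MvPolynomial (Fin (n + 1)) ℂ) →
    MvPolynomial (Fin (n + 1)) ℂ :=
    fun w w' => ∑ k, ∑ l, aeval F (extD A k l) * (w k * w' l)
  have hrad : ∀ a, X.IsRelation a → ∀ w, b (fun i => C (a i : ℂ) * F i) w ∈ J := by
    intro a ha w
    have h1 : b (fun i => C (a i : ℂ) * F i) w = ∑ l, w l *
        aeval F (∑ k, C (a k : ℂ) * MvPolynomial.X k * extD A k l) := by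
      simp only [b, map_sum, Finset.mul_sum]
      rw [Finset.sum_comm]
      refine Finset.sum_congr rfl fun l _ => Finset.sum_congr rfl fun k _ => ?_
      rw [map_mul, map_mul, aeval_X, aeval_C, algebraMap_eq]
      ring
    rw [h1]
    refine Ideal.sum_mem _ fun l _ => Ideal.mul_mem_left _ _ (Ideal.mem_map_of_mem _ ?_)
    rw [hA.sum_mul_extD ha]
    exact Ideal.mul_mem_left _ _ (mem_singularIdeal A l)
  have hanti : ∀ w w', b w w' = - b w' w := by
    intro w w'
    simp only [b]
    rw [Finset.sum_comm, ← Finset.sum_neg_distrib]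
    refine Finset.sum_congr rfl fun k _ => ?_
    rw [← Finset.sum_neg_distrib]
    refine Finset.sum_congr rfl fun l _ => ?_
    simp only [extD, map_sub]
    ring
  have hgen : ∀ w ∈ G, ∀ w' ∈ G, h * b w w' ∈ J := by
    rintro _ (⟨μ, rfl⟩ | ⟨a, ha, rfl⟩) w' hw'
    · rcases hw' with ⟨ν, rfl⟩ | ⟨a, ha, rfl⟩
      · have h1 := mem_kupkaIdeal_iff.mp hh μ ν
        rw [extD_pullback] at h1
        exact singularIdeal_pullback_le F A h1
      · rw [hanti, mul_neg]
        exact J.neg_mem (Ideal.mul_mem_left _ _ (hrad a ha _))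
    · exact Ideal.mul_mem_left _ _ (hrad a ha _)
  have hadd : ∀ w₁ w₂ w', b (w₁ + w₂) w' = b w₁ w' + b w₂ w' := fun w₁ w₂ w' => by
    simp only [b, Pi.add_apply, add_mul, mul_add, Finset.sum_add_distrib]
  have hsmul : ∀ c w w', b (c • w) w' = c * b w w' := fun c w w' => by
    simp only [b, Pi.smul_apply, smul_eq_mul, Finset.mul_sum]
    exact Finset.sum_congr rfl fun k _ => Finset.sum_congr rfl fun l _ => by ring
  have hspan : ∀ (w' : Fin m → MvPolynomial (Fin (n + 1)) ℂ),
      (∀ w ∈ G, h * b w w' ∈ J) → ∀ w ∈ M, h * b w w' ∈ J := by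
    intro w' hw' w hw
    refine Submodule.span_induction (p := fun w _ => h * b w w' ∈ J) hw' ?_ ?_ ?_ hw
    · have : b 0 w' = 0 := by simp [b]
      rw [this, mul_zero]; exact J.zero_mem
    · intro w₁ w₂ _ _ h₁ h₂
      rw [hadd, mul_add]; exact J.add_mem h₁ h₂
    · intro c w _ hw
      rw [hsmul, mul_left_comm]; exact J.mul_mem_left _ hw
  have hM : ∀ w ∈ M, ∀ w' ∈ M, h * b w w' ∈ J := by
    intro w hw w' hw'
    refine hspan w' (fun g hg => ?_) w hw
    rw [hanti, mul_neg]
    refine J.neg_mem (hspan g (fun g' hg' => hgen g' hg' g hg) w' hw')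
  have hlift : ∀ v : Fin m → ℂ, ∃ w ∈ M, ∀ k, eval x (w k) = v k := by
    intro v
    have hv : v ∈ (⊤ : Submodule ℂ (Fin m → ℂ)) := trivial
    rw [← hx] at hv
    refine Submodule.span_induction (p := fun v _ => ∃ w ∈ M, ∀ k, eval x (w k) = v k)
      ?_ ?_ ?_ ?_ hv
    · rintro _ (⟨μ, rfl⟩ | ⟨a, ha, rfl⟩)
      · exact ⟨_, Submodule.subset_span (Or.inl ⟨μ, rfl⟩), fun k => rfl⟩
      · exact ⟨_, Submodule.subset_span (Or.inr ⟨a, ha, rfl⟩), fun k => by simp⟩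
    · exact ⟨0, M.zero_mem, fun k => by simp⟩
    · rintro v₁ v₂ _ _ ⟨w₁, hw₁, h₁⟩ ⟨w₂, hw₂, h₂⟩
      exact ⟨w₁ + w₂, M.add_mem hw₁ hw₂, fun k => by simp [h₁, h₂]⟩
    · rintro c v _ ⟨w, hw, h₁⟩
      exact ⟨C c • w, M.smul_mem _ hw, fun k => by simp [h₁]⟩
  -- The rows of `W` lie in `M` and lift the standard basis at `x`. The adjugate puts `det W` times
  -- each basis vector in `M`, so `(det W)² h` multiplies every coefficient of `F^*dα` into `J̃(ω)`.
  choose w hwM hw using fun i : Fin m => hlift (Pi.single i 1)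
  let W : Matrix (Fin m) (Fin m) (MvPolynomial (Fin (n + 1)) ℂ) := Matrix.of w
  have hdet : eval x W.det = 1 := by
    rw [RingHom.map_det]
    have : (eval x).mapMatrix W = 1 := by
      ext i j
      simp [W, hw, Matrix.one_apply, Pi.single_apply, eq_comm]
    rw [this, Matrix.det_one]
  have hu : ∀ i, (Pi.single i W.det : Fin m → MvPolynomial (Fin (n + 1)) ℂ) ∈ M := by
    intro i
    have h1 : (Pi.single i W.det : Fin m → MvPolynomial (Fin (n + 1)) ℂ) =
        ∑ p, W.adjugate i p • w p := by
      ext1 j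
      have h2 := congrFun (congrFun W.adjugate_mul i) j
      rw [Matrix.mul_apply, Matrix.smul_apply, Matrix.one_apply] at h2
      rw [Finset.sum_apply]
      refine Eq.trans ?_ h2.symm
      simp [Pi.single_apply, eq_comm]
    rw [h1]
    exact M.sum_mem fun p _ => M.smul_mem _ (hwM p)
  refine ⟨W.det ^ 2, by simp [hdet], ?_⟩
  have hb : ∀ i j, b (Pi.single i W.det) (Pi.single j W.det) =
      aeval F (extD A i j) * (W.det * W.det) := by
    intro i j
    simp only [b]
    rw [Finset.sum_eq_single i, Finset.sum_eq_single j]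
    · simp
    · intro l _ hl; simp [hl]
    · simp
    · intro k _ hk; simp [hk]
    · simp
  have h1 := mem_map_iInf_colon_of_flat hflat (N := singularIdeal A)
    (Finset.univ : Finset (Fin m × Fin m)) (c := fun ij => extD A ij.1 ij.2)
    (r := W.det ^ 2 * h) (fun ij _ => by
      have h2 := hM _ (hu ij.1) _ (hu ij.2)
      rw [hb] at h2
      have h3 : W.det ^ 2 * h * (aeval F).toRingHom (extD A ij.1 ij.2) =
        h * (aeval F (extD A ij.1 ij.2) * (W.det * W.det)) := by
        change W.det ^ 2 * h * aeval F (extD A ij.1 ij.2) = _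
        ring
      rw [h3]
      exact h2)
  refine Ideal.map_mono ?_ h1
  intro p hp
  simp only [Submodule.mem_iInf, Submodule.mem_colon_singleton] at hp
  exact mem_kupkaIdeal_iff.mpr fun i j => hp (i, j) (Finset.mem_univ _)

/-- Nullstellensatz for the annihilator of `h` modulo `F^*K(α)`: it does not vanish at noncritical
points, nor at critical points outside `F⁻¹(Z)`, where some `A_i(F)` is nonzero. The origin of the
affine cone is harmless because it maps into `Z`. -/
theorem kupkaIdeal_pullback_le_saturation (hA : X.IsTwistedForm D A) (hint : IsIntegrable A)
    (hF : X.IsLifting e F)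
    (hcrit : ∀ x ∈ X.criticalCone F, ∃ i, eval (fun j => eval x (F j)) (A i) ≠ 0)
    (hflat : (aeval F : MvPolynomial (Fin m) ℂ →ₐ[ℂ] MvPolynomial (Fin (n + 1)) ℂ).toRingHom.Flat) :
    kupkaIdeal (pullback F A) ≤
      saturation ((kupkaIdeal A).map (aeval F)) (X.irrelevantIdeal.map (aeval F)) := by
  intro h hh
  have hcomp : ∀ (x : Fin (n + 1) → ℂ) (p : MvPolynomial (Fin m) ℂ),
      eval x (aeval F p) = eval (fun j => eval x (F j)) p := by
    intro x p
    induction p using MvPolynomial.induction_on with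
    | C a => simp [algebraMap_eq]
    | add p q hp hq => simp only [map_add, hp, hq]
    | mul_X p t hp => simp only [map_mul, hp, aeval_X, eval_X]
  let Q := ((kupkaIdeal A).map (aeval F)).colon {h}
  have hQ : ∀ p, p ∈ Q ↔ p * h ∈ (kupkaIdeal A).map (aeval F) := fun p => by
    rw [Submodule.mem_colon_singleton, smul_eq_mul]
  have hrad : X.irrelevantIdeal.map (aeval F) ≤ Q.radical := by
    rw [← vanishingIdeal_zeroLocus_eq_radical (K := ℂ), Ideal.map_le_iff_le_comap]
    intro g hg x hx
    rw [aeval_eq_eval]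
    by_contra hgx
    change eval x (aeval F g) ≠ 0 at hgx
    have hxQ : ∀ p ∈ Q, eval x p = 0 := fun p hp => by
      have := hx p hp
      rwa [aeval_eq_eval] at this
    have hZ : (fun i => eval x (F i)) ∉ X.irrelevantLocus := by
      intro hmem
      have h1 := hmem g hg
      rw [aeval_eq_eval] at h1
      exact hgx ((hcomp x g).trans h1)
    by_cases hspan : Submodule.span ℂ
      (Set.range (fun k : Fin (n + 1) => fun i : Fin m => eval x (pderiv k (F i))) ∪
        {w | ∃ a : Fin m → ℤ, X.IsRelation a ∧ w = fun i => (a i : ℂ) * eval x (F i)}) = ⊤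
    · obtain ⟨u, hu, huh⟩ := exists_mul_mem_map_kupkaIdeal_of_span_eq_top hA hflat hh hspan
      exact hu (hxQ u ((hQ u).mpr huh))
    · by_cases hx0 : x = 0
      · apply hZ
        intro p hp
        rw [aeval_eq_eval]
        have h0 : (fun i => eval x (F i)) = 0 := by
          ext i
          rw [hx0, Pi.zero_apply, ← hF.constantCoeff_eq_zero (injective_of_flat hflat) i]
          simp [eval_zero]
        rw [h0]
        refine Submodule.span_induction (p := fun p _ => eval (0 : Fin m → ℂ) p = 0)
          ?_ ?_ ?_ ?_ hp
        · rintro _ ⟨s, hs, rfl⟩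
          have hne : sᶜ.Nonempty := by
            rw [Finset.nonempty_iff_ne_empty, Ne, Finset.compl_eq_empty_iff]
            rintro rfl
            exact X.univ_notMem_cones hs
          obtain ⟨i, hi⟩ := hne
          rw [map_prod]
          exact Finset.prod_eq_zero hi (by simp)
        · simp
        · intro a b _ _ ha hb; rw [map_add, ha, hb, add_zero]
        · intro a b _ hb; rw [smul_eq_mul, map_mul, hb, mul_zero]
      · obtain ⟨i, hi⟩ := hcrit x ⟨hx0, hZ, hspan⟩
        refine hi ?_
        rw [← hcomp]
        refine hxQ _ ((hQ _).mpr (Ideal.mul_mem_right _ _ (Ideal.mem_map_of_mem _ ?_)))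
        exact unfoldingsIdeal_le_kupkaIdeal A
          (singularIdeal_le_unfoldingsIdeal hint (mem_singularIdeal A i))
  obtain ⟨d, hd⟩ := Ideal.exists_pow_le_of_le_radical_of_fg hrad (IsNoetherian.noetherian _)
  refine mem_saturation_iff.mpr ⟨d, fun y hy => ?_⟩
  rw [mul_comm]
  exact (hQ y).mp (hd hy)

end ToricSurface

/-! ### Components `I_ij` with independent rays -/

namespace ToricSurface

variable {m : ℕ} (X : ToricSurface m)

/-- The determinant of two rays. -/
def rayDet (i j : Fin m) : ℤ := X.ray i 0 * X.ray j 1 - X.ray i 1 * X.ray j 0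

/-- Contraction with this relation trades the index `k` for `i` and `j`. -/
theorem isRelation_rayDet (i j k : Fin m) :
    X.IsRelation (Pi.single i (X.rayDet j k) + Pi.single j (X.rayDet k i) +
      Pi.single k (X.rayDet i j)) := by
  unfold IsRelation
  simp only [Pi.add_apply, add_smul, Finset.sum_add_distrib, Pi.single_apply, ite_smul, zero_smul,
    Finset.sum_ite_eq', Finset.mem_univ, if_true]
  ext t
  fin_cases t <;> simp [rayDet] <;> ring

theorem eq_or_eq_neg_of_rayDet_eq_zero {i k : Fin m} (h : X.rayDet i k = 0) :
    X.ray k = X.ray i ∨ X.ray k = -X.ray i := by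
  obtain ⟨a, b, hab⟩ := X.primitive i
  obtain ⟨a', b', hab'⟩ := X.primitive k
  rw [rayDet] at h
  have h0 : X.ray k 0 = X.ray i 0 * (a * X.ray k 0 + b * X.ray k 1) := by
    linear_combination (-X.ray k 0) * hab - b * h
  have h1 : X.ray k 1 = X.ray i 1 * (a * X.ray k 0 + b * X.ray k 1) := by
    linear_combination (-X.ray k 1) * hab + a * h
  have hu : IsUnit (a * X.ray k 0 + b * X.ray k 1) :=
    IsUnit.of_mul_eq_one (a' * X.ray i 0 + b' * X.ray i 1)
      (by linear_combination hab' - a' * h0 - b' * h1)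
  rcases Int.isUnit_iff.mp hu with h2 | h2
  · left; ext t
    rw [h2] at h0 h1
    fin_cases t <;> simp [h0, h1]
  · right; ext t
    rw [h2] at h0 h1
    fin_cases t <;> simp [h0, h1]

theorem ray_injective : Function.Injective X.ray := by
  intro i k h
  by_contra hik
  have h1 := X.inter {i} (X.ray_mem i) {k} (X.ray_mem k)
  have h2 : (fun t => (X.ray i t : ℝ)) ∈ coneOf X.ray {i} ∩ coneOf X.ray {k} := by
    refine ⟨⟨fun _ => 1, by simp, by simp⟩, ⟨fun _ => 1, by simp, by simp [h]⟩⟩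
  rw [h1, Finset.singleton_inter_of_notMem (by simpa using hik)] at h2
  obtain ⟨c, -, hc⟩ := h2
  rw [Finset.sum_empty] at hc
  obtain ⟨a, b, hab⟩ := X.primitive i
  have h0 : X.ray i 0 = 0 := by simpa using congrFun hc 0
  have h1 : X.ray i 1 = 0 := by simpa using congrFun hc 1
  rw [h0, h1] at hab
  simp at hab

theorem rayDet_ne_zero {i j k : Fin m} (hij : X.ray j = -X.ray i) (hki : k ≠ i) (hkj : k ≠ j) :
    X.rayDet i k ≠ 0 := by
  intro h
  rcases X.eq_or_eq_neg_of_rayDet_eq_zero h with h | h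
  · exact hki (X.ray_injective h)
  · exact hkj (X.ray_injective (h.trans hij.symm))

theorem sum_single_mul (f : Fin m → MvPolynomial (Fin m) ℂ) (i : Fin m) (a : ℤ) :
    ∑ l, C (((Pi.single i a : Fin m → ℤ) l : ℤ) : ℂ) * MvPolynomial.X l * f l =
      C (a : ℂ) * MvPolynomial.X i * f i := by
  rw [Finset.sum_eq_single i]
  · simp
  · intro l _ hl; simp [hl]
  · simp

variable {X}

theorem mem_primeIdeal_iff {i j : Fin m} {p : MvPolynomial (Fin m) ℂ} :
    p ∈ primeIdeal (i, j) ↔ ∀ d ∈ p.support, d i ≠ 0 ∨ d j ≠ 0 := by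
  rw [primeIdeal, ← Set.image_pair, mem_ideal_span_X_image]
  simp

instance isPrime_primeIdeal (ij : Fin m × Fin m) : (primeIdeal ij).IsPrime := by
  classical
  let f : MvPolynomial (Fin m) ℂ →ₐ[ℂ] MvPolynomial (Fin m) ℂ :=
    aeval fun t => if t = ij.1 ∨ t = ij.2 then 0 else MvPolynomial.X t
  have hf : ∀ p, p - f p ∈ primeIdeal ij := by
    intro p
    induction p using MvPolynomial.induction_on with
    | C a => simp [f, algebraMap_eq]
    | add p q hp hq =>
      rw [map_add, add_sub_add_comm]
      exact Ideal.add_mem _ hp hq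
    | mul_X p t hp =>
      have h1 : MvPolynomial.X t - f (MvPolynomial.X t) ∈ primeIdeal ij := by
        simp only [f, aeval_X]
        split_ifs with h
        · rw [sub_zero]
          rcases h with rfl | rfl
          · exact Ideal.subset_span (Or.inl rfl)
          · exact Ideal.subset_span (Or.inr rfl)
        · simp
      rw [map_mul]
      have h2 := Ideal.add_mem _ (Ideal.mul_mem_left _ p h1)
        (Ideal.mul_mem_right (f (MvPolynomial.X t)) _ hp)
      rwa [show p * (MvPolynomial.X t - f (MvPolynomial.X t)) + (p - f p) *
        f (MvPolynomial.X t) = p * MvPolynomial.X t - f p * f (MvPolynomial.X t) by ring] at h2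
  have hker : primeIdeal ij = RingHom.ker f := by
    apply le_antisymm
    · rw [primeIdeal, Ideal.span_le]
      rintro _ (rfl | rfl) <;> simp [f, RingHom.mem_ker]
    · intro p hp
      have h1 := hf p
      rwa [RingHom.mem_ker.mp hp, sub_zero] at h1
  rw [hker]
  exact RingHom.ker_isPrime f

theorem X_notMem_primeIdeal {i j k : Fin m} (hi : k ≠ i) (hj : k ≠ j) :
    (MvPolynomial.X k : MvPolynomial (Fin m) ℂ) ∉ primeIdeal (i, j) := by
  rw [mem_primeIdeal_iff]
  simp [support_X, hi, hj]

theorem map_primeIdeal {τ : Type*} (F : Fin m → MvPolynomial τ ℂ) (i j : Fin m) :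
    (primeIdeal (i, j)).map (aeval F) = Ideal.span {F i, F j} := by
  rw [primeIdeal, Ideal.map_span, Set.image_pair, aeval_X, aeval_X]

variable {n : ℕ} {D : X.Cl} {A : OneForm (Fin m)} {F : Fin m → MvPolynomial (Fin (n + 1)) ℂ}

theorem isRelPrime_of_flat
    (hflat : (aeval F : MvPolynomial (Fin m) ℂ →ₐ[ℂ] MvPolynomial (Fin (n + 1)) ℂ).toRingHom.Flat)
    {i j : Fin m} (hij : i ≠ j) : IsRelPrime (F i) (F j) := by
  have h := isRelPrime_map_of_flat hflat (x := MvPolynomial.X i) (y := MvPolynomial.X j)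
    (X_ne_zero j) (fun a b hab => by
      have h1 : (MvPolynomial.X j : MvPolynomial (Fin m) ℂ) ∣ MvPolynomial.X i * a := ⟨b, hab⟩
      refine (X_prime.dvd_or_dvd h1).resolve_left fun h2 => ?_
      rw [X_dvd_X] at h2
      simp_all)
  simpa using h

/-- Modulo the coefficients of `α`, the coefficients of `dα` are, up to a monomial factor, multiples
of a single one. -/
theorem IsTwistedForm.exists_sq_mul_extD_sub_mem (hA : X.IsTwistedForm D A) {i j : Fin m}
    (hij : i ≠ j) {P : MvPolynomial (Fin m) ℂ}
    (hP : P = C (X.rayDet i j : ℂ) * ∏ r ∈ {i, j}ᶜ, MvPolynomial.X r) :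
    ∃ g g' : Fin m → MvPolynomial (Fin m) ℂ,
      (∀ k l, P ^ 2 * extD A k l - (g k * g' l - g' k * g l) * extD A i j ∈ singularIdeal A) ∧
      (∀ k, g k - (if k = i then P else 0) ∈ primeIdeal (i, j)) ∧
      (∀ k, g' k - (if k = j then P else 0) ∈ primeIdeal (i, j)) := by
  -- For `k ≠ i, j`, contracting `dα` with the relation among `v_i, v_j, v_k` expresses `z_k` times
  -- row `k` through rows `i` and `j` modulo `J(α)`; the other variables in `P` make the factor
  -- independent of `k`. Using this on both indices produces `P ^ 2`.
  have hrow : ∀ k, ∃ a b : MvPolynomial (Fin m) ℂ,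
      (∀ l, P * extD A k l - a * extD A i l - b * extD A j l ∈ singularIdeal A) ∧
      (k = i → a = P ∧ b = 0) ∧ (k = j → a = 0 ∧ b = P) ∧
      (k ≠ i → k ≠ j → a ∈ primeIdeal (i, j) ∧ b ∈ primeIdeal (i, j)) := by
    intro k
    by_cases hki : k = i
    · subst hki
      exact ⟨P, 0, fun l => by simp, by simp, fun h => absurd h hij, by simp⟩
    by_cases hkj : k = j
    · subst hkj
      exact ⟨0, P, fun l => by simp, fun h => absurd h hki, by simp, by simp⟩
    have hk : k ∈ ({i, j}ᶜ : Finset (Fin m)) := by simp [hki, hkj]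
    refine ⟨-C (X.rayDet j k : ℂ) * MvPolynomial.X i * ∏ r ∈ ({i, j}ᶜ : Finset (Fin m)).erase k,
      MvPolynomial.X r, -C (X.rayDet k i : ℂ) * MvPolynomial.X j *
      ∏ r ∈ ({i, j}ᶜ : Finset (Fin m)).erase k, MvPolynomial.X r, fun l => ?_,
      fun h => absurd h hki, fun h => absurd h hkj, fun _ _ => ⟨?_, ?_⟩⟩
    · have h1 := hA.sum_mul_extD (X.isRelation_rayDet i j k) l
      simp only [Pi.add_apply, Int.cast_add, map_add, add_mul, Finset.sum_add_distrib,
        sum_single_mul (fun k => extD A k l)] at h1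
      rw [hP, ← Finset.mul_prod_erase _ _ hk]
      have h2 := Ideal.mul_mem_left (singularIdeal A)
        ((∏ r ∈ ({i, j}ᶜ : Finset (Fin m)).erase k, MvPolynomial.X r) *
          C ((X.relationDegree (X.isRelation_rayDet i j k) D : ℤ) : ℂ)) (mem_singularIdeal A l)
      convert h2 using 1
      linear_combination (∏ r ∈ ({i, j}ᶜ : Finset (Fin m)).erase k, MvPolynomial.X r) * h1
    · exact Ideal.mul_mem_right _ _ (Ideal.mul_mem_left _ _ (Ideal.subset_span (Or.inl rfl)))
    · exact Ideal.mul_mem_right _ _ (Ideal.mul_mem_left _ _ (Ideal.subset_span (Or.inr rfl)))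
  choose g g' hE hi hj hk using hrow
  refine ⟨g, g', fun k l => ?_, fun k => ?_, fun k => ?_⟩
  · have h1 := Ideal.sub_mem _ (Ideal.sub_mem _ (Ideal.mul_mem_left _ P (hE k l))
      (Ideal.mul_mem_left _ (g k) (hE l i))) (Ideal.mul_mem_left _ (g' k) (hE l j))
    convert h1 using 1
    simp only [extD]
    ring
  · by_cases hki : k = i
    · simp [hki, (hi i rfl).1]
    · rw [if_neg hki, sub_zero]
      by_cases hkj : k = j
      · rw [(hj k hkj).1]; exact Ideal.zero_mem _
      · exact (hk k hki hkj).1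
  · by_cases hkj : k = j
    · simp [hkj, (hj j rfl).2]
    · rw [if_neg hkj, sub_zero]
      by_cases hki : k = i
      · rw [(hi k hki).2]; exact Ideal.zero_mem _
      · exact (hk k hki hkj).2

/-- Modulo `J(α)`, `P² dα` is its `ij` coefficient times the decomposable form `g ∧ g'`, where `g ≡
P dz_i` and `g' ≡ P dz_j` modulo `I_ij`. Pulling back and cancelling that coefficient by flatness
puts `h P(F)²` times each minor of `(F_i, F_j)` in `(F_i, F_j)`, which is impossible if `h ∉ q`. -/
theorem mem_of_mem_kupkaIdeal_pullback_of_rayDet_ne_zero (hA : X.IsTwistedForm D A)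
    (hflat : (aeval F : MvPolynomial (Fin m) ℂ →ₐ[ℂ] MvPolynomial (Fin (n + 1)) ℂ).toRingHom.Flat)
    {i j : Fin m} (hij : i ≠ j) (hdet : X.rayDet i j ≠ 0)
    (hK : kupkaIdeal A ≤ primeIdeal (i, j)) {q : Ideal (MvPolynomial (Fin (n + 1)) ℂ)}
    (hq : q ∈ (Ideal.span {F i, F j}).minimalPrimes) (hFq : ∀ k, k ≠ i → k ≠ j → F k ∉ q)
    {h : MvPolynomial (Fin (n + 1)) ℂ} (hh : h ∈ kupkaIdeal (pullback F A)) : h ∈ q := by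
  by_contra hhq
  have hqp : q.IsPrime := hq.1.1
  obtain ⟨P, hP⟩ : ∃ P : MvPolynomial (Fin m) ℂ,
      P = C (X.rayDet i j : ℂ) * ∏ r ∈ {i, j}ᶜ, MvPolynomial.X r := ⟨_, rfl⟩
  have hdetC : IsUnit (C (X.rayDet i j : ℂ) : MvPolynomial (Fin m) ℂ) :=
    (IsUnit.mk0 (X.rayDet i j : ℂ) (by exact_mod_cast hdet)).map C
  have hPp : P ∉ primeIdeal (i, j) := by
    rw [hP, Ideal.unit_mul_mem_iff_mem _ hdetC, (isPrime_primeIdeal (i, j)).prod_mem_iff]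
    rintro ⟨k, hk, hkp⟩
    simp only [Finset.mem_compl, Finset.mem_insert, Finset.mem_singleton, not_or] at hk
    exact X_notMem_primeIdeal hk.1 hk.2 hkp
  have hPq : aeval F P ∉ q := by
    rw [hP, map_mul, Ideal.unit_mul_mem_iff_mem _ (hdetC.map (aeval F)), map_prod,
      hqp.prod_mem_iff]
    rintro ⟨k, hk, hkp⟩
    simp only [Finset.mem_compl, Finset.mem_insert, Finset.mem_singleton, not_or] at hk
    rw [aeval_X] at hkp
    exact hFq k hk.1 hk.2 hkp
  obtain ⟨g, g', hgg, hg, hg'⟩ := hA.exists_sq_mul_extD_sub_mem hij hP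
  -- If `s` multiplies the `ij` coefficient into `J(α)`, then `P² s` does so for all of `dα`, so `P²
  -- s ∈ K(α) ⊆ I_ij`, while `P ∉ I_ij`.
  have hcolon : (singularIdeal A).colon {extD A i j} ≤ primeIdeal (i, j) := by
    intro s hs
    rw [Submodule.mem_colon_singleton, smul_eq_mul] at hs
    have h1 : P ^ 2 * s ∈ kupkaIdeal A := by
      refine mem_kupkaIdeal_iff.mpr fun k l => ?_
      have h2 := Ideal.add_mem _ (Ideal.mul_mem_left _ s (hgg k l))
        (Ideal.mul_mem_left _ (g k * g' l - g' k * g l) hs)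
      convert h2 using 1
      ring
    rcases (isPrime_primeIdeal (i, j)).mem_or_mem (hK h1) with h2 | h2
    · exact absurd ((isPrime_primeIdeal (i, j)).mem_of_pow_mem 2 h2) hPp
    · exact h2
  let U : (Fin m → MvPolynomial (Fin m) ℂ) → Fin (n + 1) → MvPolynomial (Fin (n + 1)) ℂ :=
    fun g μ => ∑ k, aeval F (g k) * pderiv μ (F k)
  have hU : ∀ (g : Fin m → MvPolynomial (Fin m) ℂ) (i₀ : Fin m),
      (∀ k, g k - (if k = i₀ then P else 0) ∈ primeIdeal (i, j)) → ∀ μ,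
      U g μ - aeval F P * pderiv μ (F i₀) ∈ Ideal.span {F i, F j} := by
    intro g i₀ hg μ
    have h1 : U g μ - aeval F P * pderiv μ (F i₀) =
        ∑ k, aeval F (g k - (if k = i₀ then P else 0)) * pderiv μ (F k) := by
      simp only [map_sub, sub_mul, Finset.sum_sub_distrib, U, apply_ite (aeval F), map_zero,
        ite_mul, zero_mul, Finset.sum_ite_eq', Finset.mem_univ, if_true]
    rw [h1, ← map_primeIdeal]
    exact Ideal.sum_mem _ fun k _ => Ideal.mul_mem_right _ _ (Ideal.mem_map_of_mem _ (hg k))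
  have hUmem : ∀ μ ν, h * (U g μ * U g' ν - U g' μ * U g ν) ∈ Ideal.span {F i, F j} := by
    intro μ ν
    rw [← map_primeIdeal]
    refine Ideal.map_mono hcolon (mem_map_colon_of_flat hflat ?_)
    change h * (U g μ * U g' ν - U g' μ * U g ν) * aeval F (extD A i j) ∈
      (singularIdeal A).map (aeval F)
    have h1 := singularIdeal_pullback_le F A (mem_kupkaIdeal_iff.mp hh μ ν)
    rw [extD_pullback] at h1
    have h2 : ∑ k, ∑ l, aeval F (P ^ 2 * extD A k l - (g k * g' l - g' k * g l) * extD A i j) *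
        (pderiv μ (F k) * pderiv ν (F l)) ∈ (singularIdeal A).map (aeval F) :=
      Ideal.sum_mem _ fun k _ => Ideal.sum_mem _ fun l _ =>
        Ideal.mul_mem_right _ _ (Ideal.mem_map_of_mem _ (hgg k l))
    have h3 := Ideal.sub_mem _ (Ideal.mul_mem_left _ (aeval F P ^ 2) h1)
      (Ideal.mul_mem_left _ h h2)
    convert h3 using 1
    simp only [U]
    rw [Finset.sum_mul_sum, Finset.sum_mul_sum]
    simp only [Finset.mul_sum, Finset.sum_mul, ← Finset.sum_sub_distrib]
    refine Finset.sum_congr rfl fun k _ => Finset.sum_congr rfl fun l _ => ?_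
    simp only [map_sub, map_mul, map_pow]
    ring
  have hhP : h * aeval F P ^ 2 ∉ q := fun hmem =>
    (hqp.mem_or_mem hmem).elim hhq fun h1 => hPq (hqp.mem_of_pow_mem 2 h1)
  obtain ⟨μ, ν, hμν⟩ := exists_mul_minor_notMem_span_pair (isRelPrime_of_flat hflat hij) hq hhP
  refine hμν ?_
  have hi := hU g i hg
  have hj := hU g' j hg'
  have h1 := Ideal.sub_mem _ (hUmem μ ν) (Ideal.mul_mem_left _ h
    (Ideal.sub_mem _ (Ideal.add_mem _ (Ideal.mul_mem_right (U g' ν) _ (hi μ))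
      (Ideal.mul_mem_left _ (aeval F P * pderiv μ (F i)) (hj ν)))
      (Ideal.add_mem _ (Ideal.mul_mem_right (U g ν) _ (hj μ))
      (Ideal.mul_mem_left _ (aeval F P * pderiv μ (F j)) (hi ν)))))
  convert h1 using 1
  ring

end ToricSurface

/-! ### Components `I_ij` with opposite rays -/

namespace ToricSurface

variable {m n : ℕ} {X : ToricSurface m} {D : X.Cl} {A : OneForm (Fin m)}
  {F : Fin m → MvPolynomial (Fin (n + 1)) ℂ}

theorem isRelation_single_add_single {i j : Fin m} (hij : X.ray j = -X.ray i) :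
    X.IsRelation (Pi.single i 1 + Pi.single j 1) := by
  unfold IsRelation
  simp only [Pi.add_apply, add_smul, Finset.sum_add_distrib, Pi.single_apply, ite_smul, zero_smul,
    Finset.sum_ite_eq', Finset.mem_univ, if_true, hij, one_smul, add_neg_cancel]

theorem weight_single_add_single (i j : Fin m) (d : Fin m →₀ ℕ) :
    Finsupp.weight (Pi.single i 1 + Pi.single j 1 : Fin m → ℤ) d = d i + d j := by
  rw [Finsupp.weight_apply, Finsupp.sum_fintype _ _ (by simp)]
  simp only [Pi.add_apply, smul_add, Finset.sum_add_distrib, Pi.single_apply, smul_ite, smul_zero,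
    Finset.sum_ite_eq', Finset.mem_univ, if_true, nsmul_eq_mul, mul_one]

/-- The polynomials of order at least `s` with respect to the variables `z_i, z_j`. -/
noncomputable def orderIdeal (i j : Fin m) (s : ℤ) : Ideal (MvPolynomial (Fin m) ℂ) :=
  Ideal.span ((fun d => monomial d 1) '' {d : Fin m →₀ ℕ | s ≤ d i + d j})

theorem mem_orderIdeal_iff {i j : Fin m} {s : ℤ} {p : MvPolynomial (Fin m) ℂ} :
    p ∈ orderIdeal i j s ↔ ∀ d ∈ p.support, s ≤ d i + d j := by
  rw [orderIdeal, mem_ideal_span_monomial_image]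
  refine forall₂_congr fun d _ => ⟨?_, fun h => ⟨d, h, le_rfl⟩⟩
  rintro ⟨d', hd', hle⟩
  have h1 : s ≤ d' i + d' j := hd'
  have h2 := hle i
  have h3 := hle j
  omega

theorem mem_orderIdeal_of_isWeightedHomogeneous {i j : Fin m} {s t : ℤ}
    {p : MvPolynomial (Fin m) ℂ}
    (hp : IsWeightedHomogeneous (Pi.single i 1 + Pi.single j 1 : Fin m → ℤ) p t) (h : s ≤ t) :
    p ∈ orderIdeal i j s := by
  refine mem_orderIdeal_iff.mpr fun d hd => ?_
  rwa [← weight_single_add_single, hp (mem_support_iff.mp hd)]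

/-- The part `u₀` of `u` free of `z_i, z_j` gives `u₀ b` of weight exactly `t` but order at least `t
+ 1`; so `u₀ b = 0` and `u₀ = 0`. -/
theorem orderIdeal_colon_le {i j : Fin m} (hij : i ≠ j) {t : ℤ} {b : MvPolynomial (Fin m) ℂ}
    (hb : IsWeightedHomogeneous (Pi.single i 1 + Pi.single j 1 : Fin m → ℤ) b t) (hb₀ : b ≠ 0) :
    (orderIdeal i j (t + 1)).colon {b} ≤ primeIdeal (i, j) := by
  intro u hu
  rw [Submodule.mem_colon_singleton, smul_eq_mul] at hu
  let a : Fin m → ℤ := Pi.single i 1 + Pi.single j 1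
  let u₀ := weightedHomogeneousComponent a 0 u
  have h1 : u - u₀ ∈ primeIdeal (i, j) := by
    refine mem_primeIdeal_iff.mpr fun d hd => ?_
    by_contra! hd0
    have hw : Finsupp.weight a d = 0 := by
      rw [weight_single_add_single, hd0.1, hd0.2]; simp
    rw [mem_support_iff, coeff_sub, coeff_weightedHomogeneousComponent, if_pos hw, sub_self] at hd
    exact hd rfl
  have hX : ∀ k, a k = 1 → MvPolynomial.X k * b ∈ orderIdeal i j (t + 1) := fun k hk =>
    mem_orderIdeal_of_isWeightedHomogeneous
      (IsWeightedHomogeneous.mul (isWeightedHomogeneous_X ℂ a k) hb) (by rw [hk, add_comm])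
  have h2 : ∀ v ∈ primeIdeal (i, j), v * b ∈ orderIdeal i j (t + 1) := by
    intro v hv
    obtain ⟨c, c', rfl⟩ := Ideal.mem_span_pair.mp hv
    rw [add_mul, mul_assoc, mul_assoc]
    exact Ideal.add_mem _ (Ideal.mul_mem_left _ c (hX i (by simp [a, hij])))
      (Ideal.mul_mem_left _ c' (hX j (by simp [a, hij])))
  have h3 : u₀ * b ∈ orderIdeal i j (t + 1) := by
    have h4 := Ideal.sub_mem _ hu (h2 _ h1)
    rwa [← sub_mul, sub_sub_cancel] at h4
  have h5 := IsWeightedHomogeneous.mul (weightedHomogeneousComponent_isWeightedHomogeneous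
    (w := a) 0 u) hb
  have h6 : u₀ * b = 0 := by
    by_contra hne
    obtain ⟨d, hd⟩ := exists_coeff_ne_zero hne
    have h7 := h5 hd
    have h8 := mem_orderIdeal_iff.mp h3 d (mem_support_iff.mpr hd)
    rw [weight_single_add_single] at h7
    omega
  have h7 := (mul_eq_zero.mp h6).resolve_right hb₀
  rwa [h7, sub_zero] at h1

/-- The relation `v_i + v_j = 0` gives `z_i A_i + z_j A_j = 0`, whence `b`. Contracting `dα` with
the same radial field gives `z_i` times the `ij` coefficient as a multiple of `A_j = -z_i b`. -/
theorem IsTwistedForm.exists_eq_mul_of_ray_eq_neg (hA : X.IsTwistedForm D A) {i j : Fin m}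
    (hij : i ≠ j) (hray : X.ray j = -X.ray i) :
    ∃ b, A i = MvPolynomial.X j * b ∧ A j = -(MvPolynomial.X i * b) ∧
      extD A i j = -(C ((X.relationDegree (isRelation_single_add_single hray) D : ℤ) : ℂ) * b) ∧
      IsWeightedHomogeneous (Pi.single i 1 + Pi.single j 1 : Fin m → ℤ) b
        (X.relationDegree (isRelation_single_add_single hray) D - 2) := by
  have hdes := hA.descent _ (isRelation_single_add_single hray)
  simp only [Pi.add_apply, Int.cast_add, map_add, add_mul, Finset.sum_add_distrib,
    sum_single_mul, Int.cast_one, C_1, one_mul] at hdes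
  have hdvd : (MvPolynomial.X j : MvPolynomial (Fin m) ℂ) ∣ A i := by
    have h1 : (MvPolynomial.X j : MvPolynomial (Fin m) ℂ) ∣ MvPolynomial.X i * A i :=
      ⟨-A j, by linear_combination hdes⟩
    refine (X_prime.dvd_or_dvd h1).resolve_left fun h2 => ?_
    rw [X_dvd_X] at h2
    simp_all
  obtain ⟨b, hb⟩ := hdvd
  have hXi : (MvPolynomial.X i : MvPolynomial (Fin m) ℂ) ≠ 0 := X_ne_zero i
  have hj : A j = -(MvPolynomial.X i * b) := by
    apply mul_left_cancel₀ (X_ne_zero j : (MvPolynomial.X j : MvPolynomial (Fin m) ℂ) ≠ 0)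
    rw [hb] at hdes
    linear_combination hdes
  refine ⟨b, hb, hj, ?_, ?_⟩
  · have h1 := hA.sum_mul_extD (isRelation_single_add_single hray) j
    simp only [Pi.add_apply, Int.cast_add, map_add, add_mul, Finset.sum_add_distrib,
      sum_single_mul (fun k => extD A k j), Int.cast_one, C_1, one_mul] at h1
    have h2 : extD A j j = 0 := sub_self _
    rw [h2, hj] at h1
    apply mul_left_cancel₀ hXi
    linear_combination h1
  · intro d hd
    have h1 := hA.isWeightedHomogeneous (isRelation_single_add_single hray) i
      (d := Finsupp.single j 1 + d) (by rwa [hb, coeff_X_mul])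
    rw [map_add, Finsupp.weight_single] at h1
    simp [hij] at h1
    omega

/-- Order in `z_i, z_j` isolates the `ij` coefficient: `J(α)` and the coefficients of `dα` with an
index outside `{i, j}` have order at least `δ - 1`, while the `ij` coefficient `-δ b` is nonzero of
weight `δ - 2`. Flatness and `orderIdeal_colon_le` put `h` times each minor in `(F_i, F_j)`. -/
theorem mem_of_mem_kupkaIdeal_pullback_of_ray_eq_neg (hA : X.IsTwistedForm D A)
    (hJ : 2 ≤ (saturation (singularIdeal A) X.irrelevantIdeal).height)
    (hflat : (aeval F : MvPolynomial (Fin m) ℂ →ₐ[ℂ] MvPolynomial (Fin (n + 1)) ℂ).toRingHom.Flat)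
    {i j : Fin m} (hij : i ≠ j) (hray : X.ray j = -X.ray i)
    (hJp : singularIdeal A ≤ primeIdeal (i, j)) {q : Ideal (MvPolynomial (Fin (n + 1)) ℂ)}
    (hq : q ∈ (Ideal.span {F i, F j}).minimalPrimes)
    {h : MvPolynomial (Fin (n + 1)) ℂ} (hh : h ∈ kupkaIdeal (pullback F A)) : h ∈ q := by
  by_contra hhq
  obtain ⟨b, hbi, hbj, hB, hb⟩ := hA.exists_eq_mul_of_ray_eq_neg hij hray
  have ha := isRelation_single_add_single hray
  set δ := X.relationDegree ha D with hδ
  -- If `b = 0` then `A_i = A_j = 0`, and the relations through `v_i` make the remaining `z_l A_l`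
  -- proportional. A prime factor in `I_ij` of a nonzero `A_k₀` divides no other `z_l`, so it
  -- divides all of `α`, against codimension two.
  have hb₀ : b ≠ 0 := by
    rintro rfl
    have hAi : A i = 0 := by rw [hbi, mul_zero]
    have hAj : A j = 0 := by rw [hbj, mul_zero, neg_zero]
    obtain ⟨k₀, hk₀⟩ : ∃ k, A k ≠ 0 := by
      by_contra! h0
      refine ne_bot_of_two_le_height hJ ?_
      rw [singularIdeal, Ideal.span_eq_bot]
      rintro _ ⟨k, rfl⟩
      exact h0 k
    obtain ⟨π, hπ, hdvd, hπp⟩ := exists_prime_dvd_mem hk₀ (hJp (mem_singularIdeal A k₀))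
    refine not_le_span_prime_of_two_le_height hJ hπ ?_
    rw [singularIdeal, Ideal.span_le]
    rintro _ ⟨l, rfl⟩
    rw [SetLike.mem_coe, Ideal.mem_span_singleton]
    by_cases hli : l = i
    · rw [hli, hAi]; exact dvd_zero _
    by_cases hlj : l = j
    · rw [hlj, hAj]; exact dvd_zero _
    have h1 := hA.descent _ (X.isRelation_rayDet i k₀ l)
    simp only [Pi.add_apply, Int.cast_add, map_add, add_mul, Finset.sum_add_distrib,
      sum_single_mul, hAi, mul_zero, zero_add] at h1
    have hdet : X.rayDet i k₀ ≠ 0 := X.rayDet_ne_zero hray (by rintro rfl; exact hk₀ hAi)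
      (by rintro rfl; exact hk₀ hAj)
    have hu : IsUnit (C (X.rayDet i k₀ : ℂ) : MvPolynomial (Fin m) ℂ) :=
      (IsUnit.mk0 (X.rayDet i k₀ : ℂ) (by exact_mod_cast hdet)).map C
    have h2 : π ∣ C (X.rayDet i k₀ : ℂ) * (MvPolynomial.X l * A l) := by
      have h3 : C (X.rayDet i k₀ : ℂ) * (MvPolynomial.X l * A l) =
        A k₀ * -(C (X.rayDet l i : ℂ) * MvPolynomial.X k₀) := by linear_combination h1
      rw [h3]
      exact Dvd.dvd.mul_right hdvd _
    refine (hπ.dvd_or_dvd (hu.dvd_mul_left.mp h2)).resolve_left fun h3 => ?_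
    exact X_notMem_primeIdeal hli hlj (Ideal.mem_of_dvd _ h3 hπp)
  have hδ2 : 2 ≤ δ := by
    obtain ⟨d, hd⟩ := exists_coeff_ne_zero hb₀
    have h1 := hb hd
    rw [weight_single_add_single] at h1
    omega
  have hai : ∀ k, k ≠ i → k ≠ j → (Pi.single i 1 + Pi.single j 1 : Fin m → ℤ) k = 0 := by
    intro k hki hkj; simp [hki, hkj]
  have hai1 : (Pi.single i 1 + Pi.single j 1 : Fin m → ℤ) i = 1 := by simp [hij]
  have haj1 : (Pi.single i 1 + Pi.single j 1 : Fin m → ℤ) j = 1 := by simp [hij.symm]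
  have hale : ∀ k, (Pi.single i 1 + Pi.single j 1 : Fin m → ℤ) k ≤ 1 := by
    intro k
    by_cases hki : k = i
    · rw [hki, hai1]
    · by_cases hkj : k = j
      · rw [hkj, haj1]
      · rw [hai k hki hkj]; norm_num
  have hJN : singularIdeal A ≤ orderIdeal i j (δ - 1) := by
    rw [singularIdeal, Ideal.span_le]
    rintro _ ⟨l, rfl⟩
    have := hale l
    exact mem_orderIdeal_of_isWeightedHomogeneous (hA.isWeightedHomogeneous ha l) (by omega)
  have hBN : ∀ k l, k ≠ i ∧ k ≠ j ∨ l ≠ i ∧ l ≠ j → extD A k l ∈ orderIdeal i j (δ - 1) := by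
    intro k l hkl
    have h1 : (Pi.single i 1 + Pi.single j 1 : Fin m → ℤ) k +
        (Pi.single i 1 + Pi.single j 1 : Fin m → ℤ) l ≤ 1 := by
      have := hale k
      have := hale l
      rcases hkl with h1 | h1
      · have := hai k h1.1 h1.2
        omega
      · have := hai l h1.1 h1.2
        omega
    refine Ideal.sub_mem _ ?_ ?_
    · exact mem_orderIdeal_of_isWeightedHomogeneous
        (t := δ - (Pi.single i 1 + Pi.single j 1 : Fin m → ℤ) k -
          (Pi.single i 1 + Pi.single j 1 : Fin m → ℤ) l)
        (IsWeightedHomogeneous.pderiv (hA.isWeightedHomogeneous ha l) (by ring)) (by omega)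
    · exact mem_orderIdeal_of_isWeightedHomogeneous
        (t := δ - (Pi.single i 1 + Pi.single j 1 : Fin m → ℤ) k -
          (Pi.single i 1 + Pi.single j 1 : Fin m → ℤ) l)
        (IsWeightedHomogeneous.pderiv (hA.isWeightedHomogeneous ha k) (by ring)) (by omega)
  have hcolon : (orderIdeal i j (δ - 1)).colon {extD A i j} ≤ primeIdeal (i, j) := by
    have hu : IsUnit (-C (δ : ℂ) : MvPolynomial (Fin m) ℂ) :=
      ((IsUnit.mk0 (δ : ℂ) (by exact_mod_cast (by omega : δ ≠ 0))).map C).neg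
    have h1 := orderIdeal_colon_le hij hb hb₀
    rw [show δ - 2 + 1 = δ - 1 by ring] at h1
    refine le_trans (fun u huB => ?_) h1
    rw [Submodule.mem_colon_singleton, smul_eq_mul] at huB ⊢
    rw [← Ideal.unit_mul_mem_iff_mem _ hu]
    convert huB using 1
    rw [hB]
    ring
  obtain ⟨μ, ν, hμν⟩ := exists_mul_minor_notMem_span_pair (isRelPrime_of_flat hflat hij) hq hhq
  refine hμν ?_
  rw [← map_primeIdeal]
  refine Ideal.map_mono hcolon (mem_map_colon_of_flat hflat ?_)
  change h * (pderiv μ (F i) * pderiv ν (F j) - pderiv ν (F i) * pderiv μ (F j)) *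
    aeval F (extD A i j) ∈ (orderIdeal i j (δ - 1)).map (aeval F)
  have h1 := Ideal.map_mono hJN
    (singularIdeal_pullback_le F A (mem_kupkaIdeal_iff.mp hh μ ν))
  rw [extD_pullback] at h1
  have hswap : extD A j i = -extD A i j := (neg_sub _ _).symm
  -- Removing the entries `ij` and `ji` leaves only coefficients of order at least `δ - 1`.
  have h2 : ∀ k l, aeval F (extD A k l - ((if k = i then if l = j then extD A i j else 0 else 0) -
      (if k = j then if l = i then extD A i j else 0 else 0))) *
      (pderiv μ (F k) * pderiv ν (F l)) ∈ (orderIdeal i j (δ - 1)).map (aeval F) := by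
    intro k l
    refine Ideal.mul_mem_right _ _ (Ideal.mem_map_of_mem _ ?_)
    have hii : ∀ k, extD A k k = 0 := fun k => sub_self _
    by_cases hki : k = i
    · subst hki
      by_cases hlj : l = j
      · subst hlj; simp [hij]
      · by_cases hlk : l = k
        · subst hlk; simp [hii, hij]
        · simpa [hlj, hlk] using hBN k l (Or.inr ⟨hlk, hlj⟩)
    · by_cases hkj : k = j
      · subst hkj
        by_cases hli : l = i
        · subst hli; simp [hki, hswap]
        · by_cases hlk : l = k
          · subst hlk; simp [hii, hki]
          · simpa [hki, hli, hlk] using hBN k l (Or.inr ⟨hli, hlk⟩)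
      · simpa [hki, hkj] using hBN k l (Or.inl ⟨hki, hkj⟩)
  have h3 := Ideal.sub_mem _ h1 (Ideal.mul_mem_left _ h
    (Ideal.sum_mem _ fun k (_ : k ∈ Finset.univ) => Ideal.sum_mem _ fun l (_ : l ∈ Finset.univ) =>
      h2 k l))
  convert h3 using 1
  rw [← mul_sub, ← Finset.sum_sub_distrib]
  simp only [← Finset.sum_sub_distrib, ← sub_mul, ← map_sub, sub_sub_cancel]
  simp only [map_sub, sub_mul, Finset.sum_sub_distrib, apply_ite (aeval F), map_zero, ite_mul,
    zero_mul, Finset.sum_ite_irrel, Finset.sum_const_zero, Finset.sum_ite_eq', Finset.mem_univ,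
    if_true]
  ring

end ToricSurface

theorem IsDivisionPoint.not_le {σ : Type*} {A : OneForm σ} {p : Ideal (MvPolynomial σ ℂ)}
    (h : IsDivisionPoint A p) : ¬ unfoldingsIdeal A ≤ p := by
  obtain ⟨hp, h1⟩ := h
  intro hle
  have h2 := Ideal.map_mono (f := algebraMap _ (Localization.AtPrime p)) hle h1
  rw [Localization.AtPrime.map_eq_maximalIdeal] at h2
  exact (Ideal.ne_top_iff_one _).mp (IsLocalRing.maximalIdeal.isMaximal _).ne_top h2

/-! ### Minimal primes of `F^*I(α)` and the conclusion -/

namespace ToricSurface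

variable {m n : ℕ} {X : ToricSurface m} {D : X.Cl} {A : OneForm (Fin m)} {e : Fin m → ℕ}
  {F : Fin m → MvPolynomial (Fin (n + 1)) ℂ}

/-- As `∅` and the singletons are cones, `p` contains two variables. An element of `p` outside
`I_ij` would complete them to a regular sequence of length three. -/
theorem IsFoliation.exists_eq_primeIdeal_of_irrelevantIdeal_le (hA : X.IsFoliation D A)
    {p : Ideal (MvPolynomial (Fin m) ℂ)} (hp : p ∈ (unfoldingsIdeal A).minimalPrimes)
    (hZ : X.irrelevantIdeal ≤ p) :
    ∃ i j, i < j ∧ {i, j} ∉ X.cones ∧ p = primeIdeal (i, j) := by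
  classical
  have hpp : p.IsPrime := hp.1.1
  have hcard : 1 < (Finset.univ.filter fun k => MvPolynomial.X k ∈ p).card := by
    by_contra! hle
    refine X.notMem_cones_of_irrelevantIdeal_le hZ
      (T := Finset.univ.filter fun k => MvPolynomial.X k ∈ p) (fun k hk => by simpa using hk) ?_
    rcases Nat.le_one_iff_eq_zero_or_eq_one.mp hle with h | h
    · rw [Finset.card_eq_zero.mp h]
      exact X.empty_mem_cones
    · obtain ⟨k, hk⟩ := Finset.card_eq_one.mp h
      rw [hk]
      exact X.ray_mem k
  obtain ⟨i, j, hlt, hi, hj⟩ : ∃ i j : Fin m, i < j ∧ (MvPolynomial.X i : MvPolynomial _ ℂ) ∈ p ∧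
      (MvPolynomial.X j : MvPolynomial _ ℂ) ∈ p := by
    obtain ⟨i, hi, j, hj, hij⟩ := Finset.one_lt_card.mp hcard
    simp only [Finset.mem_filter, Finset.mem_univ, true_and] at hi hj
    rcases lt_or_gt_of_ne hij with h | h
    · exact ⟨i, j, h, hi, hj⟩
    · exact ⟨j, i, h, hj, hi⟩
  have hpij : p = primeIdeal (i, j) := by
    refine le_antisymm (fun w hw => ?_) ?_
    · by_contra hwij
      refine notMem_of_mem_minimalPrimes_unfoldingsIdeal hA.integrable
        (ne_bot_of_two_le_height hA.codim_sing)
        (fun π hπ => not_le_span_prime_of_two_le_height hA.codim_sing hπ) hp hi hj X_prime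
        (fun h => ?_) (fun c hc => ?_) hw
      · rw [X_dvd_X] at h
        simp_all
      · exact ((isPrime_primeIdeal (i, j)).mem_or_mem hc).resolve_left hwij
    · rw [primeIdeal, Ideal.span_le]
      rintro _ (rfl | rfl)
      exacts [hi, hj]
  refine ⟨i, j, hlt, X.notMem_cones_of_irrelevantIdeal_le hZ fun k hk => ?_, hpij⟩
  by_contra hkij
  simp only [Finset.mem_insert, Finset.mem_singleton, not_or] at hkij
  rw [hpij] at hk
  exact X_notMem_primeIdeal hkij.1 hkij.2 hk

theorem kupkaIdeal_pullback_le_saturation_map_singularIdeal (hA : X.IsFoliation D A)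
    (hF : X.IsLifting e F) (hgen : X.AlmostGeneric F A)
    (hflat : (aeval F : MvPolynomial (Fin m) ℂ →ₐ[ℂ] MvPolynomial (Fin (n + 1)) ℂ).toRingHom.Flat) :
    kupkaIdeal (pullback F A) ≤
      saturation ((singularIdeal A).map (aeval F)) (X.irrelevantIdeal.map (aeval F)) := by
  have h1 : (kupkaIdeal A).map (aeval F) ≤
      saturation ((singularIdeal A).map (aeval F)) (X.irrelevantIdeal.map (aeval F)) :=
    map_le_saturation_map (aeval F : MvPolynomial (Fin m) ℂ →ₐ[ℂ] _).toRingHom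
      (J := singularIdeal A) (J' := kupkaIdeal A) (I := X.irrelevantIdeal)
      ((le_saturation _ _).trans hgen.kupka.le)
  exact (kupkaIdeal_pullback_le_saturation hA.toIsTwistedForm hA.integrable hF hgen.critical
    hflat).trans (saturation_le_of_le h1)

theorem kupkaIdeal_pullback_le_of_mem_minimalPrimes (hA : X.IsFoliation D A)
    (hF : X.IsLifting e F) (hgen : X.AlmostGeneric F A)
    (hflat : (aeval F : MvPolynomial (Fin m) ℂ →ₐ[ℂ] MvPolynomial (Fin (n + 1)) ℂ).toRingHom.Flat)
    (hdiv : ∀ ij ∈ X.gammaSet A \ X.gammaKupka A, IsDivisionPoint A (primeIdeal ij))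
    {q : Ideal (MvPolynomial (Fin (n + 1)) ℂ)}
    (hq : q ∈ ((unfoldingsIdeal A).map (aeval F)).minimalPrimes) :
    kupkaIdeal (pullback F A) ≤ q := by
  intro h hh
  have hqp : q.IsPrime := hq.1.1
  have hp : q.comap (aeval F) ∈ (unfoldingsIdeal A).minimalPrimes :=
    comap_mem_minimalPrimes_of_flat hflat hq
  have hJI := singularIdeal_le_unfoldingsIdeal hA.integrable
  by_cases hZ : X.irrelevantIdeal ≤ q.comap (aeval F)
  · obtain ⟨i, j, hlt, hcone, hpij⟩ := hA.exists_eq_primeIdeal_of_irrelevantIdeal_le hp hZ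
    have hIp : unfoldingsIdeal A ≤ primeIdeal (i, j) := hpij ▸ hp.1.2
    have hJp := hJI.trans hIp
    -- Otherwise `I_ij` would be a division point, which `I(α) ⊆ I_ij` rules out.
    have hKp : kupkaIdeal A ≤ primeIdeal (i, j) := by
      by_contra hK
      exact (hdiv (i, j) ⟨⟨hlt, hcone, hJp⟩, fun h => hK h.2⟩).not_le hIp
    have hmem : ∀ k, F k ∈ q ↔ (MvPolynomial.X k : MvPolynomial (Fin m) ℂ) ∈ primeIdeal (i, j) := by
      intro k
      rw [← hpij, Ideal.mem_comap, aeval_X]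
    -- A prime between `(F_i, F_j)` and `q` contains `F^*I(α)`, because `I(α) ⊆ I_ij`.
    have hqmin : q ∈ (Ideal.span {F i, F j}).minimalPrimes := by
      refine ⟨⟨hqp, ?_⟩, fun q' hq' hle => hq.2 ⟨hq'.1, ?_⟩ hle⟩
      · rw [← map_primeIdeal, ← hpij]
        exact Ideal.map_comap_le
      · exact (Ideal.map_mono hIp).trans ((map_primeIdeal F i j).le.trans hq'.2)
    by_cases hdet : X.rayDet i j = 0
    · refine mem_of_mem_kupkaIdeal_pullback_of_ray_eq_neg hA.toIsTwistedForm hA.codim_sing hflat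
        hlt.ne ((X.eq_or_eq_neg_of_rayDet_eq_zero hdet).resolve_left fun h => ?_) hJp hqmin hh
      exact hlt.ne' (X.ray_injective h)
    · exact mem_of_mem_kupkaIdeal_pullback_of_rayDet_ne_zero hA.toIsTwistedForm hflat hlt.ne hdet
        hKp hqmin (fun k hki hkj hk => X_notMem_primeIdeal hki hkj ((hmem k).mp hk)) hh
  · obtain ⟨y, hy, hyq⟩ := SetLike.not_le_iff_exists.mp hZ
    obtain ⟨d, hd⟩ := mem_saturation_iff.mp
      (kupkaIdeal_pullback_le_saturation_map_singularIdeal hA hF hgen hflat hh)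
    have h1 := hq.1.2 (Ideal.map_mono hJI
      (hd _ (Ideal.pow_mem_pow (Ideal.mem_map_of_mem (aeval F) hy) d)))
    exact (hqp.mem_or_mem h1).resolve_right fun h2 => hyq (hqp.mem_of_pow_mem d h2)

end ToricSurface

end ToricFoliation

open ToricFoliation MvPolynomial in
theorem proposition6p24 {m n : ℕ} (X : ToricSurface m) (D : X.Cl)
    (A : OneForm (Fin m)) (hA : X.IsFoliation D A)
    (e : Fin m → ℕ) (F : Fin m → MvPolynomial (Fin (n + 1)) ℂ) (hF : X.IsLifting e F)
    (hgen : X.AlmostGeneric F A)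
    (hflat : (aeval F : MvPolynomial (Fin m) ℂ →ₐ[ℂ] MvPolynomial (Fin (n + 1)) ℂ).toRingHom.Flat)
    (hdiv : ∀ ij ∈ X.gammaSet A \ X.gammaKupka A,
      IsDivisionPoint A (ToricSurface.primeIdeal ij)) :
    (saturation ((singularIdeal A).map (aeval F)) (X.irrelevantIdeal.map (aeval F)) =
        saturation ((unfoldingsIdeal A).map (aeval F)) (X.irrelevantIdeal.map (aeval F)) ∧
      saturation ((unfoldingsIdeal A).map (aeval F)) (X.irrelevantIdeal.map (aeval F)) =
        saturation (unfoldingsIdeal (pullback F A)) (X.irrelevantIdeal.map (aeval F)) ∧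
      saturation (unfoldingsIdeal (pullback F A)) (X.irrelevantIdeal.map (aeval F)) =
        saturation (kupkaIdeal (pullback F A)) (X.irrelevantIdeal.map (aeval F))) ∧
    (((unfoldingsIdeal A).map (aeval F)).radical = (unfoldingsIdeal (pullback F A)).radical ∧
      (unfoldingsIdeal (pullback F A)).radical = (kupkaIdeal (pullback F A)).radical) := by
  have hIω := map_unfoldingsIdeal_le F A
  have hKω := unfoldingsIdeal_le_kupkaIdeal (pullback F A)
  have hsat := ToricSurface.kupkaIdeal_pullback_le_saturation_map_singularIdeal hA hF hgen hflat
  have hle₁ := saturation_mono (I := X.irrelevantIdeal.map (aeval F)) (Ideal.map_mono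
    (f := (aeval F : MvPolynomial (Fin m) ℂ →ₐ[ℂ] MvPolynomial (Fin (n + 1)) ℂ))
    (singularIdeal_le_unfoldingsIdeal hA.integrable))
  have hle₂ := saturation_mono (I := X.irrelevantIdeal.map (aeval F)) hIω
  have hle₃ := saturation_mono (I := X.irrelevantIdeal.map (aeval F)) hKω
  have hle₄ := saturation_le_of_le hsat
  have hrad : (kupkaIdeal (pullback F A)).radical ≤
      ((unfoldingsIdeal A).map (aeval F)).radical := by
    rw [Ideal.radical_le_radical_iff, ← Ideal.sInf_minimalPrimes]
    exact le_sInf fun q hq =>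
      ToricSurface.kupkaIdeal_pullback_le_of_mem_minimalPrimes hA hF hgen hflat hdiv hq
  exact ⟨⟨le_antisymm hle₁ (hle₂.trans (hle₃.trans hle₄)),
    le_antisymm hle₂ (hle₃.trans (hle₄.trans hle₁)),
    le_antisymm hle₃ (hle₄.trans (hle₁.trans hle₂))⟩,
    le_antisymm (Ideal.radical_mono hIω) ((Ideal.radical_mono hKω).trans hrad),
    le_antisymm (Ideal.radical_mono hKω) (hrad.trans (Ideal.radical_mono hIω))⟩
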